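/- Let $n\ge 1$. A genus zero \emph{nodal scaled marked line} $(\overline C,\underline z,\phi)$ over $\mathbb C$ is a connected genus zero projective nodal curve $\overline C$ with distinct markings $z_0,\dots,z_n$ away from the nodes, together with, for each component $\overline C_\alpha$, a translation invariant volume form $\phi_\alpha$ on the affine line $C_\alpha=\overline C_\alpha\setminus\{z_{\alpha 0}\}$, which may be zero or infinite (\emph{degenerate}). Here $z_{\alpha i}\in\overline C_\alpha$ denotes $z_i$, if $z_i$ lies on $\overline C_\alpha$, and otherwise the node of $\overline C_\alpha$ closest to $z_i$. It is required that for each $1\le i\le n$ exactly one component on the path of components from $z_i$ to $z_0$ has a non-degenerate form, that the components on this path before it (nearer to $z_i$) have zero form and that those after it (nearer to $z_0$) have infinite form. It is \emph{stable} if every component with non-degenerate (resp. degenerate) form has at least two (resp. three) special points (markings or nodes). Let $\overline M_{n,1}(\mathbb C)$ be the set of isomorphism classes of stable nodal scaled marked lines, where isomorphisms are isomorphisms of nodal curves that preserve the markings and the volume forms. For distinct $i,j,k,l\in\{0,\dots,n\}$ let $\rho_{ijkl}$ be the value of the cross-ratio $$\rho_4(w_1,w_2,w_3,w_4)=\frac{(w_2-w_3)(w_4-w_1)}{(w_1-w_2)(w_3-w_4)}\in\mathbb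 P^1(\mathbb C)$$ at $(z_{\alpha i},z_{\alpha j},z_{\alpha k},z_{\alpha l})$ on any component $\overline C_\alpha$ on which at least three of these points are distinct; here $\rho_4=\infty$ if $w_1=w_2$ or $w_3=w_4$, $\rho_4=1$ if $w_1=w_3$ or $w_2=w_4$, and $\rho_4=0$ if $w_1=w_4$ or $w_2=w_3$. For distinct $i,j\in\{1,\dots,n\}$ let $\rho_{ij}=(\phi_\alpha(1)(z_{\alpha j}-z_{\alpha i}))^{-1}$ on the unique component on which $z_{\alpha 0},z_{\alpha i},z_{\alpha j}$ are distinct (in an affine coordinate $z$ on $C_\alpha$, with $\phi_\alpha=\phi_\alpha(1)\,dz$), with value $0$ if $\phi_\alpha$ is infinite and $\infty$ if $\phi_\alpha$ is zero. The coordinates $\rho_{ijkl}$ with $0\le i<j<k<l\le n$ and $\rho_{ij}$ with $1\le i<j\le n$ define $$\rho_{n,1}:\overline M_{n,1}(\mathbb C)\to P:=\mathbb P^1(\mathbb C)^{\binom{n+1}{4}+\binom n2}.$$ Let $A_{n,1}(\mathbb C)\subset P$ be the variety of points with all $\rho_{ijkl}\in\mathbb C\setminus\{0,1\}$ and all $\rho_{ij}\in\mathbb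 C\setminus\{0\}$ which, when the coordinates are extended to all orderings of the indices by the symmetries $$\rho_{jikl}=\rho_{ijlk}=1-\rho_{ijkl},\qquad \rho_{ikjl}=\frac{\rho_{ijkl}}{\rho_{ijkl}-1},\qquad \rho_{ij}=-\rho_{ji},$$ satisfy the recursion relations $$\rho_{jklm}=\frac{\rho_{ijkm}-1}{\rho_{ijkm}-\rho_{ijkl}},\qquad \rho_{jk}=\frac{\rho_{ij}}{-\rho_{ijk0}}$$ for all pairwise distinct $i,j,k,l,m\in\{0,\dots,n\}$, resp. all pairwise distinct $i,j,k\in\{1,\dots,n\}$. Let $\overline A_{n,1}(\mathbb C)$ be its closure in $P$ (with the product topology of the Riemann spheres). Then $\rho_{n,1}$ is a bijection from $\overline M_{n,1}(\mathbb C)$ onto $\overline A_{n,1}(\mathbb C)$. -/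

import Mathlib

open scoped OnePoint

/-- The determinant of the homogeneous coordinates `[z : 1]` (for `z : ℂ`) and `[1 : 0]` (for `∞`)
of two points of the projective line `ℙ¹(ℂ) = ℂ ∪ {∞}`. It is `x - y` for finite `x`, `y`. -/
noncomputable def homDet (x y : OnePoint ℂ) : ℂ :=
  x.elim (y.elim 0 fun _ => 1) fun a => y.elim (-1) fun b => a - b

open Classical in
/-- The cross-ratio `(w₁ - w₂)(w₃ - w₀) / ((w₀ - w₁)(w₂ - w₃))` of four points of `ℙ¹(ℂ)`, no
three of which are equal, in homogeneous coordinates. It is the image of `w₃` under the Möbius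
transformation that sends `w₀, w₁, w₂` to `0, 1, ∞`; it is `∞` if `w₀ = w₁` or `w₂ = w₃`, it is `1`
if `w₀ = w₂` or `w₁ = w₃`, and it is `0` if `w₀ = w₃` or `w₁ = w₂`. -/
noncomputable def crossRatio (w : Fin 4 → OnePoint ℂ) : OnePoint ℂ :=
  if homDet (w 0) (w 1) * homDet (w 2) (w 3) = 0 then ∞
  else ((homDet (w 1) (w 2) * homDet (w 3) (w 0) /
    (homDet (w 0) (w 1) * homDet (w 2) (w 3)) : ℂ) : OnePoint ℂ)

open Classical in
/-- The number `1 / (c (y - x))`, where `c` is the coefficient of the volume form `c dz`; it is `0`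
for the infinite and `∞` for the zero volume form. -/
noncomputable def scaledRatio (c : OnePoint ℂ) (x y : ℂ) : OnePoint ℂ :=
  c.elim ((0 : ℂ) : OnePoint ℂ) fun c =>
    if c = 0 then ∞ else (((c * (y - x))⁻¹ : ℂ) : OnePoint ℂ)

/-- A genus zero nodal scaled line with markings `z₀, z₁, …, zₙ`.

The dual graph is a finite tree, rooted at the component of `z₀` and given by its parent function.
Every component is `ℙ¹(ℂ) = ℂ ∪ {∞}` in an affine coordinate for which the special point leading
to `z₀` (that is, `z₀` itself on the root component, and otherwise the node shared with the parent
component) is `∞`; so `ℂ` is the affine line of the component. The marking `zᵢ₊₁` is the point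
`mark i` of the component `comp i`. The component `v ≠ root` is attached with its point `∞`
to the point `node v` of the component `parent v`; the value `node root` is not used.
The translation invariant volume form of the component `v` is `scale v • dz`, with
`scale v = 0` or `scale v = ∞` if it is zero or infinite. -/
structure NodalScaledLine (n : ℕ) where
  /-- the irreducible components -/
  V : Type
  finite : Finite V
  root : V
  parent : V → V
  parent_root : parent root = root
  reach_root : ∀ v, ∃ k : ℕ, parent^[k] v = root
  node : V → ℂ
  comp : Fin n → V
  mark : Fin n → ℂ
  scale : V → OnePoint ℂ
  mark_ne_mark : ∀ i j, i ≠ j → comp i = comp j → mark i ≠ mark j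
  node_ne_node : ∀ v w, v ≠ w → v ≠ root → w ≠ root → parent v = parent w → node v ≠ node w
  node_ne_mark : ∀ v i, v ≠ root → parent v = comp i → node v ≠ mark i
  /-- On the path from any marking `z₁, …, zₙ` to the root there is exactly one component with a
  non-degenerate volume form; the components before it have zero and those after it have infinite
  volume form. -/
  colored : ∀ i, ∃ k : ℕ,
    (scale (parent^[k] (comp i)) ≠ ((0 : ℂ) : OnePoint ℂ) ∧ scale (parent^[k] (comp i)) ≠ ∞) ∧
    ∀ l : ℕ, parent^[l] (comp i) ≠ parent^[k] (comp i) →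
      (l < k → scale (parent^[l] (comp i)) = ((0 : ℂ) : OnePoint ℂ)) ∧
      (k < l → scale (parent^[l] (comp i)) = ∞)

namespace NodalScaledLine

variable {n : ℕ}

/-- The volume form of the component `v` is zero or infinite. -/
def Degenerate (S : NodalScaledLine n) (v : S.V) : Prop :=
  S.scale v = ((0 : ℂ) : OnePoint ℂ) ∨ S.scale v = ∞

/-- The number of special points of the component `v`: the point at `∞`, the markings other than
`z₀`, and the nodes shared with child components. -/
noncomputable def numSpecial (S : NodalScaledLine n) (v : S.V) : ℕ :=
  1 + {i | S.comp i = v}.ncard + {w | w ≠ S.root ∧ S.parent w = v}.ncard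

/-- Each component has at least two special points, and at least three if its volume form is
degenerate. -/
def Stable (S : NodalScaledLine n) : Prop :=
  ∀ v, 2 ≤ S.numSpecial v ∧ (S.Degenerate v → 3 ≤ S.numSpecial v)

/-- An isomorphism of nodal scaled lines: an isomorphism of rooted trees and, for each component, an
isomorphism of affine lines, compatible with nodes, markings and volume forms. (An isomorphism
between projective lines that maps `∞` to `∞` is an affine map, and the pullback of `c dz` under the
affine map `g` is `c g' dz`.) -/
structure Iso (S T : NodalScaledLine n) where
  f : S.V ≃ T.V
  g : S.V → (ℂ ≃ᵃ[ℂ] ℂ)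
  map_root : f S.root = T.root
  map_parent : ∀ v, f (S.parent v) = T.parent (f v)
  map_node : ∀ v, v ≠ S.root → T.node (f v) = g (S.parent v) (S.node v)
  map_comp : ∀ i, T.comp i = f (S.comp i)
  map_mark : ∀ i, T.mark i = g (S.comp i) (S.mark i)
  map_scale : ∀ v, S.scale v = OnePoint.map (fun c => c * (g v).linear 1) (T.scale (f v))

open Classical in
/-- The special point of the component `v` that is the marking `zᵢ` or the node closest to `zᵢ`. -/
noncomputable def special (S : NodalScaledLine n) (v : S.V) : Fin (n + 1) → OnePoint ℂ :=
  Fin.cases ∞ fun i =>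
    if h : ∃ k : ℕ, S.parent^[k] (S.comp i) = v then
      if Nat.find h = 0 then (S.mark i : OnePoint ℂ)
      else (S.node (S.parent^[Nat.find h - 1] (S.comp i)) : OnePoint ℂ)
    else ∞

/-- The coordinate `ρ_{ijkl}`, for `q = (i, j, k, l)`: the cross-ratio of the four special points
on a component on which at least three of them are distinct. -/
noncomputable def rho₄ (S : NodalScaledLine n) (q : Fin 4 → Fin (n + 1)) : OnePoint ℂ :=
  Classical.epsilon fun w => ∃ v : S.V,
    3 ≤ (Set.range fun t => S.special v (q t)).ncard ∧
    w = crossRatio fun t => S.special v (q t)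

/-- The coordinate `ρ_{ij}`, evaluated on the component on which the special points of `z₀, zᵢ, zⱼ`
are distinct. The markings `z₁, …, zₙ` are indexed by `Fin n` here. -/
noncomputable def rho₂ (S : NodalScaledLine n) (i j : Fin n) : OnePoint ℂ :=
  Classical.epsilon fun w => ∃ (v : S.V) (x y : ℂ),
    S.special v i.succ = (x : OnePoint ℂ) ∧ S.special v j.succ = (y : OnePoint ℂ) ∧ x ≠ y ∧
    w = scaledRatio (S.scale v) x y

end NodalScaledLine

/-- The product of projective lines with one factor for each `i < j < k < l` in `{0, …, n}` and
one factor for each `i < j` in `{1, …, n}`. -/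
abbrev CrossRatioSpace (n : ℕ) : Type :=
  ((Fin 4 ↪o Fin (n + 1)) → OnePoint ℂ) × ((Fin 2 ↪o Fin n) → OnePoint ℂ)

/-- All the cross-ratio coordinates of a nodal scaled line. -/
noncomputable def NodalScaledLine.crossRatios {n : ℕ} (S : NodalScaledLine n) : CrossRatioSpace n :=
  (fun q => S.rho₄ q, fun p => S.rho₂ (p 0) (p 1))

/-! The remaining facts about isomorphisms are needed for the moduli space and its map. -/

namespace NodalScaledLine

variable {n : ℕ}

theorem iso_refl (S : NodalScaledLine n) : Nonempty (Iso S S) :=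
  ⟨{ f := Equiv.refl _
     g := fun _ => AffineEquiv.refl ℂ ℂ
     map_root := rfl
     map_parent := fun _ => rfl
     map_node := fun _ _ => rfl
     map_comp := fun _ => rfl
     map_mark := fun _ => rfl
     map_scale := fun v => by
      cases h : S.scale v using OnePoint.rec <;> simp [h] }⟩

theorem iso_symm {S T : NodalScaledLine n} (e : Iso S T) : Nonempty (Iso T S) :=
  ⟨{ f := e.f.symm
     g := fun v => (e.g (e.f.symm v)).symm
     map_root := by rw [← e.map_root, Equiv.symm_apply_apply]
     map_parent := fun v => by
      rw [Equiv.symm_apply_eq, e.map_parent, Equiv.apply_symm_apply]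
     map_node := fun v hv => by
      have h1 : e.f.symm v ≠ S.root := fun h => hv (by
        rw [← e.map_root, ← h, Equiv.apply_symm_apply])
      have h2 := e.map_node _ h1
      rw [Equiv.apply_symm_apply] at h2
      have h3 : e.f.symm (T.parent v) = S.parent (e.f.symm v) := by
        rw [Equiv.symm_apply_eq, e.map_parent, Equiv.apply_symm_apply]
      rw [h2, h3, AffineEquiv.symm_apply_apply]
     map_comp := fun i => by rw [e.map_comp, Equiv.symm_apply_apply]
     map_mark := fun i => by
      rw [e.map_mark, e.map_comp, Equiv.symm_apply_apply, AffineEquiv.symm_apply_apply]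
     map_scale := fun v => by
      have h := e.map_scale (e.f.symm v)
      rw [Equiv.apply_symm_apply] at h
      rw [h]
      have h1 : (e.g (e.f.symm v)).linear 1 * (e.g (e.f.symm v)).symm.linear 1 = 1 := by
        have := (e.g (e.f.symm v)).linear.apply_symm_apply 1
        rw [AffineEquiv.linear_symm]
        conv_rhs => rw [← this]
        rw [← mul_one ((e.g (e.f.symm v)).linear.symm 1)]
        conv_rhs => rw [← smul_eq_mul, map_smul, smul_eq_mul]
        rw [mul_one, mul_comm]
      cases T.scale v using OnePoint.rec with
      | infty => rfl
      | coe c => simp only [OnePoint.map_some]; rw [mul_assoc, h1, mul_one] }⟩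

theorem iso_trans {S T U : NodalScaledLine n} (e : Iso S T) (e' : Iso T U) :
    Nonempty (Iso S U) :=
  ⟨{ f := e.f.trans e'.f
     g := fun v => (e.g v).trans (e'.g (e.f v))
     map_root := by simp [e.map_root, e'.map_root]
     map_parent := fun v => by simp [e.map_parent, e'.map_parent]
     map_node := fun v hv => by
      have h1 : e.f v ≠ T.root := fun h => hv (e.f.injective (by rw [h, e.map_root]))
      simp [e'.map_node _ h1, e.map_node _ hv, e.map_parent]
     map_comp := fun i => by simp [e.map_comp, e'.map_comp]
     map_mark := fun i => by simp [e.map_mark, e'.map_mark, e.map_comp]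
     map_scale := fun v => by
      rw [e.map_scale, e'.map_scale]
      have h1 : ((e.g v).trans (e'.g (e.f v))).linear 1 =
          (e'.g (e.f v)).linear 1 * (e.g v).linear 1 := by
        have : ((e.g v).trans (e'.g (e.f v))).linear 1 =
          (e'.g (e.f v)).linear ((e.g v).linear 1 • 1) := by simp; rfl
        rw [this, map_smul, smul_eq_mul, mul_comm]
      rw [h1]
      simp only [Equiv.trans_apply]
      cases U.scale (e'.f (e.f v)) using OnePoint.rec with
      | infty => rfl
      | coe c => simp only [OnePoint.map_some]; rw [mul_assoc] }⟩

open Classical in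
theorem Iso.special_eq {S T : NodalScaledLine n} (e : Iso S T) (v : S.V) (i : Fin (n + 1)) :
    T.special (e.f v) i = OnePoint.map (e.g v) (S.special v i) := by
  have hit : ∀ (k : ℕ) (w : S.V), T.parent^[k] (e.f w) = e.f (S.parent^[k] w) := fun k w =>
    ((Function.Semiconj.iterate_right (f := e.f) (fun x => e.map_parent x) k) w).symm
  cases i using Fin.cases with
  | zero => simp [special]
  | succ i =>
    simp only [special, Fin.cases_succ]
    have hP : ∀ k : ℕ, T.parent^[k] (T.comp i) = e.f v ↔ S.parent^[k] (S.comp i) = v := fun k => by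
      rw [e.map_comp, hit, e.f.apply_eq_iff_eq]
    by_cases h : ∃ k : ℕ, S.parent^[k] (S.comp i) = v
    · have h' : ∃ k : ℕ, T.parent^[k] (T.comp i) = e.f v := by simpa only [hP] using h
      have hf : Nat.find h' = Nat.find h := Nat.find_congr' (hP _)
      rw [dif_pos h, dif_pos h', hf]
      have hs := Nat.find_spec h
      by_cases h0 : Nat.find h = 0
      · rw [if_pos h0, if_pos h0, OnePoint.map_some, e.map_mark]
        rw [h0] at hs
        simp only [Function.iterate_zero, id] at hs
        rw [hs]
      · rw [if_neg h0, if_neg h0, OnePoint.map_some, e.map_comp, hit]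
        obtain ⟨k, hk⟩ := Nat.exists_eq_succ_of_ne_zero h0
        have hpar : S.parent (S.parent^[k] (S.comp i)) = v := by
          rw [hk, Function.iterate_succ_apply'] at hs; exact hs
        have hne : S.parent^[k] (S.comp i) ≠ S.root := by
          intro hr
          refine Nat.find_min h (m := k) (by omega) ?_
          rw [hr, S.parent_root] at hpar
          rw [hr, hpar]
        rw [hk, Nat.succ_sub_one, e.map_node _ hne, hpar]
    · have h' : ¬ ∃ k : ℕ, T.parent^[k] (T.comp i) = e.f v := by simpa only [hP] using h
      rw [dif_neg h, dif_neg h', OnePoint.map_infty]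

end NodalScaledLine

theorem affineEquiv_sub (g : ℂ ≃ᵃ[ℂ] ℂ) (x y : ℂ) : g x - g y = g.linear 1 * (x - y) := by
  have h1 : g x - g y = g.linear (x - y) := by
    have := g.toAffineMap.linearMap_vsub x y
    simpa [vsub_eq_sub] using this.symm
  have h2 : g.linear ((x - y) • 1) = (x - y) • g.linear 1 := map_smul _ _ _
  rw [smul_eq_mul, mul_one, smul_eq_mul] at h2
  rw [h1, h2, mul_comm]

theorem affineEquiv_linear_ne_zero (g : ℂ ≃ᵃ[ℂ] ℂ) : g.linear 1 ≠ 0 := fun h =>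
  one_ne_zero (g.linear.injective (by rw [h, map_zero]))

theorem homDet_map (g : ℂ ≃ᵃ[ℂ] ℂ) (x y : OnePoint ℂ) :
    homDet (OnePoint.map g x) (OnePoint.map g y) =
      g.linear 1 * x.elim (g.linear 1)⁻¹ (fun _ => 1) * y.elim (g.linear 1)⁻¹ (fun _ => 1) *
        homDet x y := by
  have h := affineEquiv_linear_ne_zero g
  cases x using OnePoint.rec <;> cases y using OnePoint.rec <;>
    simp [homDet, affineEquiv_sub, h]

theorem crossRatio_map (g : ℂ ≃ᵃ[ℂ] ℂ) (w : Fin 4 → OnePoint ℂ) :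
    crossRatio (fun t => OnePoint.map g (w t)) = crossRatio w := by
  have h := affineEquiv_linear_ne_zero g
  have he : ∀ x : OnePoint ℂ, x.elim (g.linear 1)⁻¹ (fun _ => 1) ≠ 0 := fun x => by
    cases x using OnePoint.rec <;> simp [h]
  simp only [crossRatio, homDet_map]
  have h0 := he (w 0)
  have h1 := he (w 1)
  have h2 := he (w 2)
  have h3 := he (w 3)
  generalize (w 0).elim (g.linear 1)⁻¹ (fun _ => 1) = e0 at *
  generalize (w 1).elim (g.linear 1)⁻¹ (fun _ => 1) = e1 at *
  generalize (w 2).elim (g.linear 1)⁻¹ (fun _ => 1) = e2 at *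
  generalize (w 3).elim (g.linear 1)⁻¹ (fun _ => 1) = e3 at *
  generalize g.linear 1 = a at *
  by_cases hd : homDet (w 0) (w 1) * homDet (w 2) (w 3) = 0
  · rw [if_pos hd, if_pos]
    linear_combination (a * e0 * e1 * a * e2 * e3) * hd
  · rw [if_neg hd, if_neg]
    · congr 1
      have h5 := left_ne_zero_of_mul hd
      have h6 := right_ne_zero_of_mul hd
      field_simp
    · have h5 := left_ne_zero_of_mul hd
      have h6 := right_ne_zero_of_mul hd
      simp [*]

theorem scaledRatio_map (g : ℂ ≃ᵃ[ℂ] ℂ) (c : OnePoint ℂ) (x y : ℂ) :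
    scaledRatio (OnePoint.map (fun c => c * g.linear 1) c) x y = scaledRatio c (g x) (g y) := by
  have h := affineEquiv_linear_ne_zero g
  cases c using OnePoint.rec with
  | infty => rfl
  | coe c => simp [scaledRatio, affineEquiv_sub, h, mul_assoc]

namespace NodalScaledLine

variable {n : ℕ}

theorem Iso.crossRatios_eq {S T : NodalScaledLine n} (e : Iso S T) :
    S.crossRatios = T.crossRatios := by
  have hinj : ∀ v, Function.Injective (OnePoint.map (e.g v)) := fun v =>
    Option.map_injective (e.g v).injective
  refine Prod.ext (funext fun q => ?_) (funext fun p => ?_)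
  · refine congrArg Classical.epsilon (funext fun w => propext ?_)
    rw [← e.f.exists_congr_right]
    refine exists_congr fun v => ?_
    simp only [e.special_eq, crossRatio_map]
    have : (Set.range fun t => OnePoint.map (e.g v) (S.special v (q t))) =
        OnePoint.map (e.g v) '' Set.range fun t => S.special v (q t) := by
      rw [← Set.range_comp]; rfl
    rw [this, Set.ncard_image_of_injective _ (hinj v)]
  · refine congrArg Classical.epsilon (funext fun w => propext ?_)
    rw [← e.f.exists_congr_right]
    refine exists_congr fun v => ?_
    simp only [e.special_eq, e.map_scale v, scaledRatio_map]
    constructor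
    · rintro ⟨x, y, hx, hy, hxy, hw⟩
      exact ⟨e.g v x, e.g v y, by rw [hx, OnePoint.map_some], by rw [hy, OnePoint.map_some],
        fun h => hxy ((e.g v).injective h), hw⟩
    · rintro ⟨x, y, hx, hy, hxy, hw⟩
      refine ⟨(e.g v).symm x, (e.g v).symm y, hinj v ?_, hinj v ?_, fun h => hxy
        ((e.g v).symm.injective h), ?_⟩
      · rw [hx, OnePoint.map_some, AffineEquiv.apply_symm_apply]
      · rw [hy, OnePoint.map_some, AffineEquiv.apply_symm_apply]
      · rw [hw, AffineEquiv.apply_symm_apply, AffineEquiv.apply_symm_apply]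

end NodalScaledLine

/-- Isomorphism of stable nodal scaled lines. -/
def stableScaledLineSetoid (n : ℕ) : Setoid {S : NodalScaledLine n // S.Stable} where
  r S T := Nonempty (NodalScaledLine.Iso S.1 T.1)
  iseqv :=
    { refl := fun S => S.1.iso_refl
      symm := fun ⟨e⟩ => NodalScaledLine.iso_symm e
      trans := fun ⟨e⟩ ⟨e'⟩ => NodalScaledLine.iso_trans e e' }

/-- The moduli space `M̄_{n,1}(ℂ)`: isomorphism classes of stable nodal scaled lines with markings
`z₀, …, zₙ`. -/
def ScaledModuli (n : ℕ) : Type 1 := Quotient (stableScaledLineSetoid n)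

/-- The map `ρ_{n,1}` given by all the cross-ratio coordinates. -/
noncomputable def crossRatioMap (n : ℕ) : ScaledModuli n → CrossRatioSpace n :=
  Quotient.lift (fun S => S.1.crossRatios) fun _ _ ⟨e⟩ => e.crossRatios_eq

/-- A system of non-degenerate cross-ratio coordinates `r i j k l = ρ_{ijkl}` (for pairwise distinct
indices in `{0, …, n}`) and `s i j = ρ_{ij}` (for distinct indices in `{1, …, n}`, indexed by
`Fin n`), that satisfies the symmetry and recursion relations. The relations are written without
denominators. -/
structure IsCrossRatioSystem {n : ℕ} (r : Fin (n + 1) → Fin (n + 1) → Fin (n + 1) → Fin (n + 1) → ℂ)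
    (s : Fin n → Fin n → ℂ) : Prop where
  r_ne : ∀ i j k l, [i, j, k, l].Nodup → r i j k l ≠ 0 ∧ r i j k l ≠ 1
  s_ne : ∀ i j, i ≠ j → s i j ≠ 0
  r_symm₁ : ∀ i j k l, [i, j, k, l].Nodup → r j i k l = 1 - r i j k l
  r_symm₂ : ∀ i j k l, [i, j, k, l].Nodup → r i j l k = 1 - r i j k l
  r_symm₃ : ∀ i j k l, [i, j, k, l].Nodup → r i k j l * (r i j k l - 1) = r i j k l
  s_symm : ∀ i j, i ≠ j → s i j = -s j i
  r_recursion : ∀ i j k l m, [i, j, k, l, m].Nodup →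
    r j k l m * (r i j k m - r i j k l) = r i j k m - 1
  s_recursion : ∀ i j k, [i, j, k].Nodup →
    s j k * (-r i.succ j.succ k.succ 0) = s i j

/-- The variety cut out by the relations in the part of the product of projective lines where
all `ρ_{ijkl}` lie in `ℂ \ {0, 1}` and all `ρ_{ij}` lie in `ℂ \ {0}`. The coordinates for
indices that are not in increasing order are determined by the symmetry relations. -/
def openCrossRatioVariety (n : ℕ) : Set (CrossRatioSpace n) :=
  {p | ∃ r s, IsCrossRatioSystem r s ∧
    (∀ q : Fin 4 ↪o Fin (n + 1), p.1 q = ((r (q 0) (q 1) (q 2) (q 3) : ℂ) : OnePoint ℂ)) ∧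
    ∀ q : Fin 2 ↪o Fin n, p.2 q = ((s (q 0) (q 1) : ℂ) : OnePoint ℂ)}

/-- The closure `Ā_{n,1}(ℂ)` in the product of projective lines. -/
def crossRatioVariety (n : ℕ) : Set (CrossRatioSpace n) := closure (openCrossRatioVariety n)

/-! An irreducible line with form `dz` is a configuration of distinct points `z₁, …, zₙ` of `ℂ` up
to translation, with `ρ_{ij} = 1 / (z_j - z_i)`. The relations say that the numbers `1 / ρ_{ij}` are
additive and determine all cross-ratios (`s_inv_add`, `r_eq`). So the open variety is exactly the
set of coordinates of such configurations (`exists_config_of_mem`, `configCrossRatios_mem`), and the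
rest concerns their limits. `IsLimit` expresses that for every component `v` the moving coordinate
`(z - b v) / e v` sends the markings to the special points in the limit, while `dz = e v • d((z - b
v) / e v)` tends to the form of `v`. Cross-ratios are affine invariants, continuous wherever three
of the four points are distinct, so the coordinates of the family tend to those of the nodal line
(`IsLimit.tendsto_crossRatios`).

Image in the closure: a stable line is the limit of the family `smoothing`, in which each component
is inserted at its node with a radius that is a power of `t`, the exponents increasing away from the
root (`Stable.exists_isLimit`). Uniqueness of limits also shows that the coordinates do not depend
on the component used to compute them.

Injectivity: on a component where the special points of `z₀, zᵢ, zⱼ` are distinct, the cross-ratios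
give all other special points and `ρ_{ij}` gives the form. The remaining components are
non-degenerate and lie between those of zero and those of infinite form. The tree is then recovered
from the special points (`exists_matches`, `Stable.below_iff`).

Surjectivity: a point of the closure is a limit of configurations along an ultrafilter. There all
orders of growth are comparable, so the discs spanned by pairs of points, together with the unit
discs, are nested or disjoint up to comparability. They form a finite tree, limits in each disc
exist by compactness, and the result is a stable line with the given coordinates
(`DiscSystem.exists_isLimit`). -/

open Filter Topology Asymptotics

/-! ### Homogeneous coordinates and continuity of the cross-ratio. -/

/-- The point `[a : b]` of the projective line. -/
noncomputable def projMk (X : ℂ × ℂ) : OnePoint ℂ :=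
  open Classical in if X.2 = 0 then ∞ else ((X.1 / X.2 : ℂ) : OnePoint ℂ)

/-- The homogeneous coordinates `[x : 1]` and `[1 : 0]`. -/
noncomputable def homCoord (x : OnePoint ℂ) : ℂ × ℂ := x.elim (1, 0) fun a => (a, 1)

/-- The determinant of two vectors of `ℂ²`. -/
def vecDet (X Y : ℂ × ℂ) : ℂ := X.1 * Y.2 - X.2 * Y.1

/-- `X` are homogeneous coordinates of `x`. -/
def IsHomCoord (X : ℂ × ℂ) (x : OnePoint ℂ) : Prop := ∃ a : ℂ, a ≠ 0 ∧ X = a • homCoord x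

@[simp] theorem homCoord_coe (a : ℂ) : homCoord (a : OnePoint ℂ) = (a, 1) := rfl

@[simp] theorem homCoord_infty : homCoord ∞ = (1, 0) := rfl

theorem homDet_eq_vecDet (x y : OnePoint ℂ) : homDet x y = vecDet (homCoord x) (homCoord y) := by
  cases x using OnePoint.rec <;> cases y using OnePoint.rec <;>
    simp [homDet, vecDet]

theorem homDet_eq_zero {x y : OnePoint ℂ} : homDet x y = 0 ↔ x = y := by
  cases x using OnePoint.rec <;> cases y using OnePoint.rec <;>
    simp [homDet, sub_eq_zero]

theorem homDet_comm (x y : OnePoint ℂ) : homDet x y = -homDet y x := by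
  simp only [homDet_eq_vecDet, vecDet]; ring

theorem projMk_smul {a : ℂ} (ha : a ≠ 0) (X : ℂ × ℂ) : projMk (a • X) = projMk X := by
  by_cases h : X.2 = 0
  · simp [projMk, h]
  · simp [projMk, h, ha, mul_div_mul_left]

theorem crossRatio_eq_projMk (w : Fin 4 → OnePoint ℂ) :
    crossRatio w = projMk (homDet (w 1) (w 2) * homDet (w 3) (w 0),
      homDet (w 0) (w 1) * homDet (w 2) (w 3)) := rfl

/-- Both entries of the pair are linear in each of the four vectors, so rescaling the vectors
multiplies the pair by a common factor. -/
theorem crossRatio_eq_of_isHomCoord {w : Fin 4 → OnePoint ℂ} {W : Fin 4 → ℂ × ℂ}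
    (h : ∀ t, IsHomCoord (W t) (w t)) :
    crossRatio w = projMk (vecDet (W 1) (W 2) * vecDet (W 3) (W 0),
      vecDet (W 0) (W 1) * vecDet (W 2) (W 3)) := by
  choose a ha hW using h
  have hdet : ∀ s t, vecDet (W s) (W t) = a s * a t * homDet (w s) (w t) := fun s t => by
    rw [hW, hW, homDet_eq_vecDet]; simp only [vecDet, Prod.smul_fst, Prod.smul_snd, smul_eq_mul]
    ring
  have ha' : a 0 * a 1 * a 2 * a 3 ≠ 0 := by simp [ha]
  rw [crossRatio_eq_projMk, ← projMk_smul ha']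
  simp only [hdet, Prod.smul_mk, smul_eq_mul]
  congr 2 <;> ring

theorem scaledRatio_eq_of_isHomCoord {c : OnePoint ℂ} {X : ℂ × ℂ} (h : IsHomCoord X c) {x y : ℂ}
    (hxy : x ≠ y) : scaledRatio c x y = projMk (X.2, X.1 * (y - x)) := by
  obtain ⟨a, ha, rfl⟩ := h
  have hs : y - x ≠ 0 := sub_ne_zero.2 hxy.symm
  cases c using OnePoint.rec with
  | infty => simp [scaledRatio, projMk, ha, hs]
  | coe c =>
    by_cases hc : c = 0
    · simp [scaledRatio, projMk, hc]
    · simp only [scaledRatio, projMk, homCoord_coe, OnePoint.elim_some, hc, Prod.smul_mk,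
        smul_eq_mul, mul_eq_zero, ha, hs, if_false, or_self]
      congr 1
      field_simp

theorem tendsto_infty_iff {T : Type*} {l : Filter T} {f : T → OnePoint ℂ} :
    Tendsto f l (𝓝 ∞) ↔ ∀ R : ℝ, ∀ᶠ t in l, ∀ x : ℂ, f t = x → R ≤ ‖x‖ := by
  have hb : (coclosedCompact ℂ) = Bornology.cobounded ℂ := by
    rw [coclosedCompact_eq_cocompact, Metric.cobounded_eq_cocompact]
  rw [OnePoint.nhds_infty_eq, hb]
  constructor
  · intro h R
    have hs : {y : OnePoint ℂ | ∀ x : ℂ, y = x → R ≤ ‖x‖} ∈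
        map ((↑) : ℂ → OnePoint ℂ) (Bornology.cobounded ℂ) ⊔ pure ∞ := by
      refine mem_sup.2 ⟨?_, ?_⟩
      · rw [mem_map]
        filter_upwards [tendsto_norm_cobounded_atTop.eventually_ge_atTop R] with x hx y hy
        rwa [← OnePoint.coe_injective hy]
      · rw [mem_pure]
        intro x hx
        exact absurd hx (OnePoint.infty_ne_coe x)
    exact h hs
  · intro h s hs
    obtain ⟨h1, h2⟩ := mem_sup.1 hs
    rw [mem_map, ← comap_norm_atTop, mem_comap] at h1
    obtain ⟨u, hu, hus⟩ := h1
    obtain ⟨R, hR⟩ := mem_atTop_sets.1 hu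
    rw [mem_map]
    filter_upwards [h R] with t ht
    cases hf : f t using OnePoint.rec with
    | infty => rw [Set.mem_preimage, hf]; exact mem_pure.1 h2
    | coe x => rw [Set.mem_preimage, hf]; exact hus (hR _ (ht x hf))

theorem tendsto_coe_infty_iff {T : Type*} {l : Filter T} {f : T → ℂ} :
    Tendsto (fun t => (f t : OnePoint ℂ)) l (𝓝 ∞) ↔ Tendsto (fun t => ‖f t‖) l atTop := by
  rw [tendsto_infty_iff, tendsto_atTop]
  simp

theorem tendsto_coe_coe_iff {T : Type*} {l : Filter T} {f : T → ℂ} {x : ℂ} :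
    Tendsto (fun t => (f t : OnePoint ℂ)) l (𝓝 (x : OnePoint ℂ)) ↔ Tendsto f l (𝓝 x) :=
  (OnePoint.isOpenEmbedding_coe.tendsto_nhds_iff).symm

theorem continuousAt_projMk {X : ℂ × ℂ} (h : X ≠ 0) : ContinuousAt projMk X := by
  by_cases h2 : X.2 = 0
  · have h1 : X.1 ≠ 0 := fun h1 => h (Prod.ext h1 h2)
    have hX : projMk X = ∞ := by simp [projMk, h2]
    rw [ContinuousAt, hX, tendsto_infty_iff]
    intro R
    -- Positivity of this continuous function near `X` is the bound `R < ‖Y.1 / Y.2‖` without the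
    -- denominator.
    have hc : ContinuousAt (fun Y : ℂ × ℂ => ‖Y.1‖ - R * ‖Y.2‖) X := by fun_prop
    have hpos : 0 < ‖X.1‖ - R * ‖X.2‖ := by simp [h2, h1]
    filter_upwards [hc.eventually (lt_mem_nhds hpos)] with Y hY x hx
    by_cases hY2 : Y.2 = 0
    · simp [projMk, hY2] at hx
    · simp only [projMk, hY2, if_false, OnePoint.coe_eq_coe] at hx
      rw [← hx, norm_div, le_div_iff₀ (norm_pos_iff.2 hY2)]
      linarith
  · have : projMk =ᶠ[𝓝 X] fun Y => ((Y.1 / Y.2 : ℂ) : OnePoint ℂ) := by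
      filter_upwards [continuous_snd.continuousAt.eventually_ne h2] with Y hY
      simp [projMk, hY]
    refine ContinuousAt.congr ?_ this.symm
    exact OnePoint.continuous_coe.continuousAt.comp
      (continuous_fst.continuousAt.div continuous_snd.continuousAt h2)

/-- `homCoord` is not continuous at `∞`, so the lift uses the chart `[x : 1]` near a finite limit
and `[1 : x⁻¹]` near `∞`. -/
theorem exists_isHomCoord_tendsto {T : Type*} {l : Filter T} {f : T → OnePoint ℂ} {x : OnePoint ℂ}
    (h : Tendsto f l (𝓝 x)) : ∃ (F : T → ℂ × ℂ) (X : ℂ × ℂ), Tendsto F l (𝓝 X) ∧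
      (∀ᶠ t in l, IsHomCoord (F t) (f t)) ∧ IsHomCoord X x := by
  cases x using OnePoint.rec with
  | coe x =>
    refine ⟨fun t => homCoord (f t), homCoord x, ?_, .of_forall fun t => ⟨1, one_ne_zero, by simp⟩,
      ⟨1, one_ne_zero, by simp⟩⟩
    have : ContinuousAt homCoord (x : OnePoint ℂ) := by
      rw [OnePoint.continuousAt_coe]
      have : (homCoord ∘ ((↑) : ℂ → OnePoint ℂ)) = fun a => (a, 1) := rfl
      rw [this]
      fun_prop
    exact this.tendsto.comp h
  | infty =>
    refine ⟨fun t => (1, (f t).elim 0 (·⁻¹)), (1, 0), ?_, ?_, ⟨1, one_ne_zero, by simp⟩⟩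
    · refine tendsto_const_nhds.prodMk_nhds ?_
      have : ContinuousAt (fun y : OnePoint ℂ => (y.elim 0 (·⁻¹) : ℂ)) ∞ := by
        rw [OnePoint.continuousAt_infty', coclosedCompact_eq_cocompact,
          ← Metric.cobounded_eq_cocompact]
        exact tendsto_inv₀_cobounded
      exact this.tendsto.comp h
    -- The bound `1` keeps `f t` away from `0`, where `0⁻¹ = 0` would give a wrong vector.
    · filter_upwards [tendsto_infty_iff.1 h 1] with t ht
      cases hf : f t using OnePoint.rec with
      | infty => exact ⟨1, one_ne_zero, by simp⟩
      | coe y =>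
        have hy : y ≠ 0 := by
          rintro rfl
          have := ht 0 hf
          norm_num at this
        exact ⟨y⁻¹, inv_ne_zero hy, by simp [hy]⟩

/-- The four determinants are the edges of the cycle `0, 1, 2, 3`, and each product consists of two
opposite edges. If both products vanish, two adjacent edges collapse, three of the points coincide,
and at most two values remain. -/
theorem homDet_mul_ne_zero_of_three_le_ncard {w : Fin 4 → OnePoint ℂ}
    (h : 3 ≤ (Set.range w).ncard) :
    homDet (w 1) (w 2) * homDet (w 3) (w 0) ≠ 0 ∨ homDet (w 0) (w 1) * homDet (w 2) (w 3) ≠ 0 := by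
  by_contra! hc
  simp only [mul_eq_zero, homDet_eq_zero] at hc
  have key : ∀ a b : OnePoint ℂ, (∀ t, w t = a ∨ w t = b) → False := fun a b hab => by
    have h1 : Set.range w ⊆ {a, b} := by rintro _ ⟨t, rfl⟩; simpa using hab t
    have h2 := Set.ncard_le_ncard h1
    have h3 := Set.ncard_insert_le a {b}
    rw [Set.ncard_singleton] at h3
    omega
  obtain ⟨h1 | h1, h2 | h2⟩ := hc
  · exact key (w 1) (w 3) fun t => by fin_cases t <;> simp [h1, h2]
  · exact key (w 1) (w 0) fun t => by fin_cases t <;> simp [h1, h2]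
  · exact key (w 0) (w 2) fun t => by fin_cases t <;> simp [h1, h2]
  · exact key (w 0) (w 1) fun t => by fin_cases t <;> simp [h1, h2]

theorem tendsto_crossRatio {T : Type*} {l : Filter T} {f : T → Fin 4 → OnePoint ℂ}
    {w : Fin 4 → OnePoint ℂ} (h : ∀ s, Tendsto (fun t => f t s) l (𝓝 (w s)))
    (hw : 3 ≤ (Set.range w).ncard) :
    Tendsto (fun t => crossRatio (f t)) l (𝓝 (crossRatio w)) := by
  choose F X hF hFf hX using fun s => exists_isHomCoord_tendsto (h s)
  have hne : (vecDet (X 1) (X 2) * vecDet (X 3) (X 0), vecDet (X 0) (X 1) * vecDet (X 2) (X 3)) ≠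
      (0 : ℂ × ℂ) := by
    have hX' := hX
    choose a ha hW using hX'
    have hdet : ∀ s t, vecDet (X s) (X t) = a s * a t * homDet (w s) (w t) := fun s t => by
      rw [hW, hW, homDet_eq_vecDet]; simp only [vecDet, Prod.smul_fst, Prod.smul_snd, smul_eq_mul]
      ring
    have := homDet_mul_ne_zero_of_three_le_ncard hw
    simp only [hdet, ne_eq, Prod.mk_eq_zero, not_and_or]
    simpa [ha] using this
  have hd : ∀ s t, Tendsto (fun u => vecDet (F s u) (F t u)) l (𝓝 (vecDet (X s) (X t))) :=
    fun s t => ((hF s).fst_nhds.mul (hF t).snd_nhds).sub ((hF s).snd_nhds.mul (hF t).fst_nhds)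
  rw [crossRatio_eq_of_isHomCoord hX]
  refine ((continuousAt_projMk hne).tendsto.comp
    (((hd 1 2).mul (hd 3 0)).prodMk_nhds ((hd 0 1).mul (hd 2 3)))).congr' ?_
  filter_upwards [eventually_all.2 hFf] with t ht
  exact (crossRatio_eq_of_isHomCoord ht).symm

/-- With three distinct points fixed, the cross-ratio is a Möbius function of the fourth. -/
theorem crossRatio_injective_of_eq {w w' : Fin 4 → OnePoint ℂ} {s : Fin 4}
    (h : ∀ t, t ≠ s → w t = w' t) (hinj : ∀ t u, t ≠ s → u ≠ s → t ≠ u → w t ≠ w u)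
    (hc : crossRatio w = crossRatio w') : w s = w' s := by
  have hcross : homDet (w 1) (w 2) * homDet (w 3) (w 0) *
      (homDet (w' 0) (w' 1) * homDet (w' 2) (w' 3)) =
      homDet (w' 1) (w' 2) * homDet (w' 3) (w' 0) *
      (homDet (w 0) (w 1) * homDet (w 2) (w 3)) := by
    by_cases h1 : homDet (w 0) (w 1) * homDet (w 2) (w 3) = 0 <;>
    by_cases h2 : homDet (w' 0) (w' 1) * homDet (w' 2) (w' 3) = 0
    · rw [h1, h2, mul_zero, mul_zero]
    · simp [crossRatio, h1, h2] at hc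
    · simp [crossRatio, h1, h2] at hc
    · simp only [crossRatio, h1, h2, if_false, OnePoint.coe_eq_coe] at hc
      rwa [div_eq_div_iff h1 h2] at hc
  have hd : ∀ t u, t ≠ s → u ≠ s → t ≠ u → homDet (w t) (w u) ≠ 0 := fun t u ht hu htu hz =>
    hinj t u ht hu htu (homDet_eq_zero.1 hz)
  rw [← homDet_eq_zero]
  have hp : ∀ t, t ≠ s → w' t = w t := fun t ht => (h t ht).symm
  fin_cases s
  · have e1 := hp 1 (by decide); have e2 := hp 2 (by decide); have e3 := hp 3 (by decide)
    have d12 := hd 1 2 (by decide) (by decide) (by decide)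
    have d23 := hd 2 3 (by decide) (by decide) (by decide)
    have d13 := hd 1 3 (by decide) (by decide) (by decide)
    simp only [e1, e2, e3] at hcross
    -- By the Plücker relation the cross-multiplied equation factors into the determinants of the
    -- three fixed points and that of the two candidates. The other positions are treated alike.
    refine (mul_eq_zero.1 (?_ : homDet (w 1) (w 2) * homDet (w 2) (w 3) * homDet (w 1) (w 3) *
      homDet (w 0) (w' 0) = 0)).resolve_left (mul_ne_zero (mul_ne_zero d12 d23) d13)
    simp only [homDet_eq_vecDet, vecDet] at hcross ⊢
    linear_combination hcross
  · have e0 := hp 0 (by decide); have e2 := hp 2 (by decide); have e3 := hp 3 (by decide)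
    have d02 := hd 0 2 (by decide) (by decide) (by decide)
    have d23 := hd 2 3 (by decide) (by decide) (by decide)
    have d03 := hd 3 0 (by decide) (by decide) (by decide)
    simp only [e0, e2, e3] at hcross
    refine (mul_eq_zero.1 (?_ : homDet (w 0) (w 2) * homDet (w 2) (w 3) * homDet (w 3) (w 0) *
      homDet (w 1) (w' 1) = 0)).resolve_left (mul_ne_zero (mul_ne_zero d02 d23) d03)
    simp only [homDet_eq_vecDet, vecDet] at hcross ⊢
    linear_combination hcross
  · have e0 := hp 0 (by decide); have e1 := hp 1 (by decide); have e3 := hp 3 (by decide)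
    have d01 := hd 0 1 (by decide) (by decide) (by decide)
    have d13 := hd 1 3 (by decide) (by decide) (by decide)
    have d03 := hd 3 0 (by decide) (by decide) (by decide)
    simp only [e0, e1, e3] at hcross
    refine (mul_eq_zero.1 (?_ : homDet (w 0) (w 1) * homDet (w 1) (w 3) * homDet (w 3) (w 0) *
      homDet (w 2) (w' 2) = 0)).resolve_left (mul_ne_zero (mul_ne_zero d01 d13) d03)
    simp only [homDet_eq_vecDet, vecDet] at hcross ⊢
    linear_combination -hcross
  · have e0 := hp 0 (by decide); have e1 := hp 1 (by decide); have e2 := hp 2 (by decide)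
    have d01 := hd 0 1 (by decide) (by decide) (by decide)
    have d12 := hd 1 2 (by decide) (by decide) (by decide)
    have d02 := hd 0 2 (by decide) (by decide) (by decide)
    simp only [e0, e1, e2] at hcross
    refine (mul_eq_zero.1 (?_ : homDet (w 0) (w 1) * homDet (w 1) (w 2) * homDet (w 0) (w 2) *
      homDet (w 3) (w' 3) = 0)).resolve_left (mul_ne_zero (mul_ne_zero d01 d12) d02)
    simp only [homDet_eq_vecDet, vecDet] at hcross ⊢
    linear_combination -hcross

/-- The affine automorphism `x ↦ a x + b` of the line. -/
noncomputable def affineMulAdd (a : ℂ) (ha : a ≠ 0) (b : ℂ) : ℂ ≃ᵃ[ℂ] ℂ :=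
  (LinearEquiv.smulOfNeZero ℂ ℂ a ha).toAffineEquiv.trans (AffineEquiv.constVAdd ℂ ℂ b)

@[simp] theorem affineMulAdd_apply (a : ℂ) (ha : a ≠ 0) (b x : ℂ) :
    affineMulAdd a ha b x = a * x + b := by
  simp [affineMulAdd, add_comm]

@[simp] theorem affineMulAdd_linear (a : ℂ) (ha : a ≠ 0) (b : ℂ) :
    (affineMulAdd a ha b).linear 1 = a := by
  have := affineEquiv_sub (affineMulAdd a ha b) 1 0
  simpa using this.symm

/-! ### The rooted tree of components and its special points. -/

namespace NodalScaledLine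

variable {n : ℕ} (S : NodalScaledLine n)

/-- The component `v` lies on the path from `u` to the root. -/
def Below (u v : S.V) : Prop := ∃ k : ℕ, S.parent^[k] u = v

/-- The special points of `zᵢ` and `zⱼ` on the component `v` are finite and distinct. -/
def Separates (v : S.V) (i j : Fin n) : Prop :=
  S.special v i.succ ≠ ∞ ∧ S.special v j.succ ≠ ∞ ∧ S.special v i.succ ≠ S.special v j.succ

/-- The number of components between `v` and the root. -/
noncomputable def depth (v : S.V) : ℕ := {u | S.Below v u}.ncard

variable {S}

theorem Below.refl (u : S.V) : S.Below u u := ⟨0, rfl⟩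

theorem Below.trans {u v w : S.V} (h : S.Below u v) (h' : S.Below v w) : S.Below u w := by
  obtain ⟨k, rfl⟩ := h
  obtain ⟨l, rfl⟩ := h'
  exact ⟨l + k, Function.iterate_add_apply _ _ _ _⟩

theorem below_parent (u : S.V) : S.Below u (S.parent u) := ⟨1, rfl⟩

theorem below_root (u : S.V) : S.Below u S.root := S.reach_root u

theorem iterate_parent_root (k : ℕ) : S.parent^[k] S.root = S.root :=
  Function.iterate_fixed S.parent_root k

theorem eq_root_of_iterate {u : S.V} {k : ℕ} (hk : k ≠ 0) (h : S.parent^[k] u = u) :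
    u = S.root := by
  obtain ⟨m, hm⟩ := S.reach_root u
  have h1 : S.parent^[k * m] u = u := by
    rw [Function.iterate_mul]; exact Function.iterate_fixed h m
  -- `k * m ≥ m` steps up from `u` pass through the root and stay there, yet they return to `u`.
  obtain ⟨d, hd⟩ := Nat.exists_eq_add_of_le (Nat.le_mul_of_pos_left m (Nat.pos_of_ne_zero hk))
  rw [hd, add_comm, Function.iterate_add_apply, hm, iterate_parent_root] at h1
  exact h1.symm

theorem Below.antisymm {u v : S.V} (h : S.Below u v) (h' : S.Below v u) : u = v := by
  obtain ⟨k, rfl⟩ := h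
  obtain ⟨l, hl⟩ := h'
  rw [← Function.iterate_add_apply] at hl
  by_cases hz : k = 0
  · simp [hz]
  · have := eq_root_of_iterate (by omega) hl
    rw [this, iterate_parent_root]

theorem Below.total {u v w : S.V} (h : S.Below u v) (h' : S.Below u w) :
    S.Below v w ∨ S.Below w v := by
  obtain ⟨k, rfl⟩ := h
  obtain ⟨l, rfl⟩ := h'
  rcases le_total k l with hkl | hkl
  · obtain ⟨d, rfl⟩ := Nat.exists_eq_add_of_le hkl
    exact .inl ⟨d, by rw [← Function.iterate_add_apply, add_comm]⟩
  · obtain ⟨d, rfl⟩ := Nat.exists_eq_add_of_le hkl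
    exact .inr ⟨d, by rw [← Function.iterate_add_apply, add_comm]⟩

theorem Below.parent_below {u v : S.V} (h : S.Below u v) (hne : u ≠ v) :
    S.Below (S.parent u) v := by
  obtain ⟨k, rfl⟩ := h
  cases k with
  | zero => exact absurd rfl hne
  | succ k => exact ⟨k, (Function.iterate_succ_apply _ _ _).symm⟩

theorem parent_ne {u : S.V} (h : u ≠ S.root) : S.parent u ≠ u := fun h' =>
  h (eq_root_of_iterate (k := 1) one_ne_zero h')

theorem Below.exists_child {u v : S.V} (h : S.Below u v) (hne : u ≠ v) :
    ∃ w, w ≠ S.root ∧ S.parent w = v ∧ S.Below u w := by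
  classical
  obtain ⟨k, hk⟩ := Nat.exists_eq_succ_of_ne_zero (n := Nat.find h) (fun h0 => hne (by
    have := Nat.find_spec h; rwa [h0] at this))
  have hs := Nat.find_spec h
  rw [hk, Function.iterate_succ_apply'] at hs
  refine ⟨S.parent^[k] u, fun hr => Nat.find_min h (m := k) (by omega) ?_, hs, ⟨k, rfl⟩⟩
  rw [hr, S.parent_root] at hs
  rw [hr, hs]

theorem depth_lt {u v : S.V} (h : S.Below u v) (hne : u ≠ v) : S.depth v < S.depth u := by
  have := S.finite
  refine Set.ncard_lt_ncard ⟨fun w hw => h.trans hw, fun hsub => hne ?_⟩ (Set.toFinite _)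
  exact h.antisymm (hsub (Below.refl u))

theorem special_zero (v : S.V) : S.special v 0 = ∞ := rfl

theorem special_succ_of_not_below {v : S.V} {i : Fin n} (h : ¬ S.Below (S.comp i) v) :
    S.special v i.succ = ∞ := dif_neg h

theorem special_comp (i : Fin n) : S.special (S.comp i) i.succ = S.mark i := by
  classical
  have h : ∃ k : ℕ, S.parent^[k] (S.comp i) = S.comp i := ⟨0, rfl⟩
  have h0 : Nat.find h = 0 := (Nat.find_eq_zero h).2 rfl
  simp only [special, Fin.cases_succ]
  rw [dif_pos h, if_pos]
  convert h0

/-- The path of `zᵢ` enters `parent w` through a unique child, which is `w`. Together with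
`special_comp` this replaces the `Nat.find` of the definition in all later arguments. -/
theorem special_parent {w : S.V} (hw : w ≠ S.root) {i : Fin n} (hi : S.Below (S.comp i) w) :
    S.special (S.parent w) i.succ = S.node w := by
  classical
  have h : ∃ k : ℕ, S.parent^[k] (S.comp i) = S.parent w := hi.trans (below_parent w)
  have hs := Nat.find_spec h
  have h0 : Nat.find h ≠ 0 := fun h0 => by
    rw [h0] at hs
    have hs : S.comp i = S.parent w := hs
    exact parent_ne hw ((below_parent w).antisymm (hs ▸ hi)).symm
  have hu : S.parent^[Nat.find h - 1] (S.comp i) = w := by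
    obtain ⟨k, hk⟩ := Nat.exists_eq_succ_of_ne_zero h0
    rw [hk, Function.iterate_succ_apply'] at hs
    rw [hk, Nat.succ_sub_one]
    by_contra hne
    rcases Below.total (u := S.comp i) (v := S.parent^[k] (S.comp i)) ⟨k, rfl⟩ hi with h1 | h1
    · have := h1.parent_below hne
      rw [hs] at this
      exact parent_ne hw (this.antisymm (below_parent w))
    · have := h1.parent_below (Ne.symm hne)
      rw [← hs] at this
      have h2 := this.antisymm (below_parent _)
      exact Nat.find_min h (m := k) (by omega) (h2.symm.trans hs)
  simp only [special, Fin.cases_succ]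
  rw [dif_pos h, if_neg]
  · congr 2
  · convert h0

theorem special_ne_infty_iff {v : S.V} {i : Fin n} :
    S.special v i.succ ≠ ∞ ↔ S.Below (S.comp i) v := by
  refine ⟨fun h => by_contra fun h' => h (special_succ_of_not_below h'), fun h => ?_⟩
  by_cases hv : S.comp i = v
  · rw [← hv, special_comp]; exact OnePoint.coe_ne_infty _
  · obtain ⟨w, hw, rfl, hiw⟩ := h.exists_child hv
    rw [special_parent hw hiw]; exact OnePoint.coe_ne_infty _

/-- From `v`, everything beyond `u` is seen through one and the same node. -/
theorem special_eq_of_below {u v : S.V} (h : S.Below u v) (hne : u ≠ v) {i j : Fin n}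
    (hi : S.Below (S.comp i) u) (hj : S.Below (S.comp j) u) :
    S.special v i.succ = S.special v j.succ := by
  obtain ⟨w, hw, rfl, huw⟩ := h.exists_child hne
  rw [special_parent hw (hi.trans huw), special_parent hw (hj.trans huw)]

theorem Separates.below_left {v : S.V} {i j : Fin n} (h : S.Separates v i j) :
    S.Below (S.comp i) v := special_ne_infty_iff.1 h.1

theorem Separates.below_right {v : S.V} {i j : Fin n} (h : S.Separates v i j) :
    S.Below (S.comp j) v := special_ne_infty_iff.1 h.2.1

theorem Separates.symm {v : S.V} {i j : Fin n} (h : S.Separates v i j) : S.Separates v j i :=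
  ⟨h.2.1, h.1, h.2.2.symm⟩

theorem Separates.eq_of_below {u v : S.V} {i j : Fin n} (h : S.Separates v i j) (huv : S.Below u v)
    (hi : S.Below (S.comp i) u) (hj : S.Below (S.comp j) u) : u = v :=
  by_contra fun hne => h.2.2 (special_eq_of_below huv hne hi hj)

theorem Separates.unique {u v : S.V} {i j : Fin n} (hu : S.Separates u i j)
    (hv : S.Separates v i j) : u = v := by
  rcases hu.below_left.total hv.below_left with h | h
  · exact hv.eq_of_below h hu.below_left hu.below_right
  · exact (hu.eq_of_below h hv.below_left hv.below_right).symm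

theorem Separates.exists_coe {v : S.V} {i j : Fin n} (h : S.Separates v i j) :
    ∃ x y : ℂ, S.special v i.succ = x ∧ S.special v j.succ = y ∧ x ≠ y := by
  obtain ⟨x, hx⟩ := OnePoint.ne_infty_iff_exists.1 h.1
  obtain ⟨y, hy⟩ := OnePoint.ne_infty_iff_exists.1 h.2.1
  refine ⟨x, y, hx.symm, hy.symm, ?_⟩
  rintro rfl
  exact h.2.2 (hx.symm.trans hy)

/-- Markings and nodes on a component are distinct points, so two markings can share a special point
only by lying behind the same node. -/
theorem exists_child_of_special_eq {v : S.V} {i j : Fin n} (hij : i ≠ j)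
    (hi : S.Below (S.comp i) v) (hj : S.Below (S.comp j) v)
    (h : S.special v i.succ = S.special v j.succ) :
    ∃ w, w ≠ S.root ∧ S.parent w = v ∧ S.Below (S.comp i) w ∧ S.Below (S.comp j) w := by
  by_cases hvi : S.comp i = v <;> by_cases hvj : S.comp j = v
  · subst hvi
    rw [special_comp, ← hvj, special_comp, OnePoint.coe_eq_coe] at h
    exact absurd h (S.mark_ne_mark i j hij hvj.symm)
  · obtain ⟨w, hw, hwv, hjw⟩ := hj.exists_child hvj
    rw [← hwv, special_parent hw hjw, hwv, ← hvi, special_comp, OnePoint.coe_eq_coe] at h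
    exact absurd h.symm (S.node_ne_mark w i hw (hwv.trans hvi.symm))
  · obtain ⟨w, hw, hwv, hiw⟩ := hi.exists_child hvi
    rw [← hwv, special_parent hw hiw, hwv, ← hvj, special_comp, OnePoint.coe_eq_coe] at h
    exact absurd h (S.node_ne_mark w j hw (hwv.trans hvj.symm))
  · obtain ⟨w, hw, hwv, hiw⟩ := hi.exists_child hvi
    obtain ⟨w', hw', hwv', hjw⟩ := hj.exists_child hvj
    refine ⟨w, hw, hwv, hiw, ?_⟩
    by_cases hww : w = w'
    · rwa [hww]
    · refine absurd ?_ (S.node_ne_node w w' hww hw hw' (hwv.trans hwv'.symm))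
      rw [← OnePoint.coe_eq_coe, ← special_parent hw hiw, ← special_parent hw' hjw, hwv, hwv', h]

/-- The component is the deepest one common to both paths to the root. -/
theorem exists_separates {i j : Fin n} (hij : i ≠ j) : ∃ v, S.Separates v i j := by
  have := S.finite
  have : Nonempty {v // S.Below (S.comp i) v ∧ S.Below (S.comp j) v} :=
    ⟨⟨S.root, below_root _, below_root _⟩⟩
  obtain ⟨⟨v, hi, hj⟩, hmax⟩ :=
    Finite.exists_max fun v : {v // S.Below (S.comp i) v ∧ S.Below (S.comp j) v} => S.depth v.1
  refine ⟨v, special_ne_infty_iff.2 hi, special_ne_infty_iff.2 hj, fun h => ?_⟩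
  obtain ⟨w, hw, rfl, hiw, hjw⟩ := exists_child_of_special_eq hij hi hj h
  have h1 := depth_lt (below_parent w) (parent_ne hw).symm
  have h2 : S.depth w ≤ S.depth (S.parent w) := hmax ⟨w, hiw, hjw⟩
  omega

/-- This is the median of three leaves of a tree. If the component separating `i` and `j` sees `k`
at the special point of one of them, then that one and `k` are separated deeper, where the other is
seen at `∞`. -/
theorem exists_special_injective {a b c : Fin (n + 1)} (hab : a ≠ b) (hac : a ≠ c) (hbc : b ≠ c) :
    ∃ v, S.special v a ≠ S.special v b ∧ S.special v a ≠ S.special v c ∧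
      S.special v b ≠ S.special v c := by
  have key : ∀ i j : Fin n, i ≠ j → ∃ v, S.special v i.succ ≠ S.special v j.succ ∧
      S.special v 0 ≠ S.special v i.succ ∧ S.special v 0 ≠ S.special v j.succ := fun i j hij => by
    obtain ⟨v, h1, h2, h3⟩ := S.exists_separates hij
    exact ⟨v, h3, h1.symm, h2.symm⟩
  cases a using Fin.cases with
  | zero =>
    obtain ⟨j, rfl⟩ := Fin.exists_succ_eq.2 hab.symm
    obtain ⟨k, rfl⟩ := Fin.exists_succ_eq.2 hac.symm
    obtain ⟨v, h1, h2, h3⟩ := key j k (by simpa using hbc)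
    exact ⟨v, h2, h3, h1⟩
  | succ i =>
  cases b using Fin.cases with
  | zero =>
    obtain ⟨k, rfl⟩ := Fin.exists_succ_eq.2 hbc.symm
    obtain ⟨v, h1, h2, h3⟩ := key i k (by simpa using hac)
    exact ⟨v, h2.symm, h1, h3⟩
  | succ j =>
  cases c using Fin.cases with
  | zero =>
    obtain ⟨v, h1, h2, h3⟩ := key i j (by simpa using hab)
    exact ⟨v, h1, h2.symm, h3.symm⟩
  | succ k =>
  have hij : i ≠ j := by simpa using hab
  have hik : i ≠ k := by simpa using hac
  have hjk : j ≠ k := by simpa using hbc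
  obtain ⟨v, hv⟩ := S.exists_separates hij
  by_cases h1 : S.special v k.succ = S.special v i.succ
  · obtain ⟨u, hu⟩ := S.exists_separates hik
    have huv : S.Below u v := by
      rcases hu.below_left.total hv.below_left with h | h
      · exact h
      · have hk : S.Below (S.comp k) v := special_ne_infty_iff.1 (h1 ▸ hv.1)
        rw [hu.eq_of_below h hv.below_left hk]; exact Below.refl _
    have hne : u ≠ v := by
      rintro rfl
      exact hu.2.2 h1.symm
    have hj : S.special u j.succ = ∞ := by
      by_contra hj
      exact hne (hv.eq_of_below huv hu.below_left (special_ne_infty_iff.1 hj))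
    exact ⟨u, hj ▸ hu.1, hu.2.2, hj ▸ hu.2.1.symm⟩
  by_cases h2 : S.special v k.succ = S.special v j.succ
  · obtain ⟨u, hu⟩ := S.exists_separates hjk
    have huv : S.Below u v := by
      rcases hu.below_left.total hv.below_right with h | h
      · exact h
      · have hk : S.Below (S.comp k) v := special_ne_infty_iff.1 (h2 ▸ hv.2.1)
        rw [hu.eq_of_below h hv.below_right hk]; exact Below.refl _
    have hne : u ≠ v := by
      rintro rfl
      exact hu.2.2 h2.symm
    have hi : S.special u i.succ = ∞ := by
      by_contra hi
      exact hne (hv.eq_of_below huv (special_ne_infty_iff.1 hi) hu.below_left)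
    exact ⟨u, hi ▸ hu.1.symm, hi ▸ hu.2.1.symm, hu.2.2⟩
  · exact ⟨v, hv.2.2, Ne.symm h1, Ne.symm h2⟩

theorem three_le_ncard_range {w : Fin 4 → OnePoint ℂ} {s t u : Fin 4} (h1 : w s ≠ w t)
    (h2 : w s ≠ w u) (h3 : w t ≠ w u) : 3 ≤ (Set.range w).ncard := by
  have : ({w s, w t, w u} : Set (OnePoint ℂ)).ncard = 3 :=
    Set.ncard_eq_three.2 ⟨_, _, _, h1, h2, h3, rfl⟩
  rw [← this]
  refine Set.ncard_le_ncard ?_ (Set.finite_range w)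
  rintro _ (rfl | rfl | rfl) <;> exact ⟨_, rfl⟩

theorem exists_three_le_ncard {q : Fin 4 → Fin (n + 1)} (hq : Function.Injective q) :
    ∃ v, 3 ≤ (Set.range fun t => S.special v (q t)).ncard := by
  obtain ⟨v, h1, h2, h3⟩ := S.exists_special_injective (hq.ne (by decide : (0 : Fin 4) ≠ 1))
    (hq.ne (by decide : (0 : Fin 4) ≠ 2)) (hq.ne (by decide : (1 : Fin 4) ≠ 2))
  exact ⟨v, three_le_ncard_range (w := fun t => S.special v (q t)) h1 h2 h3⟩

/-- A deepest component beyond `v` has no child, so its second special point must be a marking.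
Hence the colouring along paths of markings governs every component. -/
theorem Stable.exists_below (hS : S.Stable) (v : S.V) : ∃ i, S.Below (S.comp i) v := by
  have := S.finite
  have : Nonempty {u // S.Below u v} := ⟨⟨v, Below.refl v⟩⟩
  obtain ⟨⟨u, hu⟩, hmax⟩ := Finite.exists_max fun u : {u // S.Below u v} => S.depth u.1
  have hs := (hS u).1
  rw [numSpecial] at hs
  have hB : {w | w ≠ S.root ∧ S.parent w = u} = ∅ := by
    refine Set.eq_empty_of_forall_notMem fun w ⟨hw, hwu⟩ => ?_
    subst hwu
    have h1 := depth_lt (below_parent w) (parent_ne hw).symm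
    have h2 : S.depth w ≤ S.depth (S.parent w) := hmax ⟨w, (below_parent w).trans hu⟩
    omega
  rw [hB, Set.ncard_empty] at hs
  obtain ⟨i, hi⟩ := Set.nonempty_of_ncard_ne_zero (s := {i | S.comp i = u}) (by omega)
  have hi : S.comp i = u := hi
  exact ⟨i, hi ▸ hu⟩

theorem exists_nondegenerate (S : NodalScaledLine n) (i : Fin n) : ∃ N, S.Below (S.comp i) N ∧
    (S.scale N ≠ ((0 : ℂ) : OnePoint ℂ) ∧ S.scale N ≠ ∞) ∧
    (∀ u, S.Below (S.comp i) u → S.Below u N → u ≠ N → S.scale u = ((0 : ℂ) : OnePoint ℂ)) ∧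
    (∀ u, S.Below N u → u ≠ N → S.scale u = ∞) := by
  obtain ⟨k, hk, h⟩ := S.colored i
  refine ⟨S.parent^[k] (S.comp i), ⟨k, rfl⟩, hk, ?_, ?_⟩
  · rintro _ ⟨l, rfl⟩ hl hne
    refine (h l hne).1 (not_le.1 fun hkl => hne (hl.antisymm ?_))
    exact ⟨l - k, by rw [← Function.iterate_add_apply, Nat.sub_add_cancel hkl]⟩
  · rintro _ ⟨m, rfl⟩ hne
    rw [← Function.iterate_add_apply] at hne ⊢
    refine (h _ hne).2 (Nat.lt_add_of_pos_left (Nat.pos_of_ne_zero ?_))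
    rintro rfl
    simp at hne

theorem Stable.scale_eq_zero_of_below (hS : S.Stable) {u v : S.V} (h : S.Below u v) (hne : u ≠ v)
    (hv : S.scale v ≠ ∞) : S.scale u = ((0 : ℂ) : OnePoint ℂ) := by
  obtain ⟨i, hi⟩ := hS.exists_below u
  obtain ⟨N, hN, hN', h1, h2⟩ := S.exists_nondegenerate i
  have hvN : S.Below v N := by
    rcases (hi.trans h).total hN with h3 | h3
    · exact h3
    · by_cases hvN : v = N
      · rw [hvN]; exact Below.refl _
      · exact absurd (h2 v h3 hvN) hv
  refine h1 u hi (h.trans hvN) ?_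
  rintro rfl
  exact hne (h.antisymm hvN)

theorem Stable.scale_eq_infty_of_below (hS : S.Stable) {u v : S.V} (h : S.Below u v) (hne : u ≠ v)
    (hu : S.scale u ≠ ((0 : ℂ) : OnePoint ℂ)) : S.scale v = ∞ :=
  by_contra fun hv => hu (hS.scale_eq_zero_of_below h hne hv)

/-- Two of the at least three special points are finite, and a marking lies at or behind each. So
only non-degenerate components can fail to be seen by some `ρ_{ij}`. -/
theorem Stable.exists_separates_of_degenerate (hS : S.Stable) {v : S.V} (h : S.Degenerate v) :
    ∃ i j, S.Separates v i j := by
  have := S.finite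
  have h3 := (hS v).2 h
  rw [numSpecial] at h3
  by_cases hA : 1 < {i | S.comp i = v}.ncard
  · obtain ⟨i, j, hi, hj, hij⟩ := (Set.one_lt_ncard_iff (Set.toFinite _)).1 hA
    have hi : S.comp i = v := hi
    have hj : S.comp j = v := hj
    have e1 := S.special_comp i
    have e2 := S.special_comp j
    rw [hi] at e1
    rw [hj] at e2
    refine ⟨i, j, ?_, ?_, ?_⟩
    · rw [e1]; exact OnePoint.coe_ne_infty _
    · rw [e2]; exact OnePoint.coe_ne_infty _
    · rw [e1, e2, Ne, OnePoint.coe_eq_coe]; exact S.mark_ne_mark i j hij (hi.trans hj.symm)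
  by_cases hB : 1 < {w | w ≠ S.root ∧ S.parent w = v}.ncard
  · obtain ⟨w, w', ⟨hw, rfl⟩, ⟨hw', hwv'⟩, hww⟩ := (Set.one_lt_ncard_iff (Set.toFinite _)).1 hB
    obtain ⟨i, hi⟩ := hS.exists_below w
    obtain ⟨j, hj⟩ := hS.exists_below w'
    have e1 := special_parent hw hi
    have e2 := special_parent hw' hj
    rw [hwv'] at e2
    refine ⟨i, j, ?_, ?_, ?_⟩
    · rw [e1]; exact OnePoint.coe_ne_infty _
    · rw [e2]; exact OnePoint.coe_ne_infty _
    · rw [e1, e2, Ne, OnePoint.coe_eq_coe]; exact S.node_ne_node w w' hww hw hw' hwv'.symm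
  · obtain ⟨i, hi⟩ := Set.nonempty_of_ncard_ne_zero (s := {i | S.comp i = v}) (by omega)
    obtain ⟨w, hw, rfl⟩ := Set.nonempty_of_ncard_ne_zero
      (s := {w | w ≠ S.root ∧ S.parent w = v}) (by omega)
    have hi : S.comp i = _ := hi
    obtain ⟨j, hj⟩ := hS.exists_below w
    have e1 := S.special_comp i
    have e2 := special_parent hw hj
    rw [hi] at e1
    refine ⟨i, j, ?_, ?_, ?_⟩
    · rw [e1]; exact OnePoint.coe_ne_infty _
    · rw [e2]; exact OnePoint.coe_ne_infty _
    · rw [e1, e2, Ne, OnePoint.coe_eq_coe]; exact (S.node_ne_mark w i hw hi.symm).symm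

theorem two_le_numSpecial {v : S.V} {i : Fin n} (h : S.Below (S.comp i) v) :
    2 ≤ S.numSpecial v := by
  have := S.finite
  rw [numSpecial]
  by_cases hv : S.comp i = v
  · have := Set.ncard_pos (s := {i | S.comp i = v}) (Set.toFinite _) |>.2 ⟨i, hv⟩
    omega
  · obtain ⟨w, hw, hwv, -⟩ := h.exists_child hv
    have := Set.ncard_pos (s := {w | w ≠ S.root ∧ S.parent w = v}) (Set.toFinite _) |>.2
      ⟨w, hw, hwv⟩
    omega

theorem Separates.three_le_numSpecial {v : S.V} {i j : Fin n} (h : S.Separates v i j) :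
    3 ≤ S.numSpecial v := by
  have := S.finite
  rw [numSpecial]
  have hij : i ≠ j := by
    rintro rfl
    exact h.2.2 rfl
  have posA : ∀ i, S.comp i = v → 0 < {i | S.comp i = v}.ncard := fun i hi =>
    Set.ncard_pos (Set.toFinite _) |>.2 ⟨i, hi⟩
  have posB : ∀ w, w ≠ S.root → S.parent w = v → 0 < {w | w ≠ S.root ∧ S.parent w = v}.ncard :=
    fun w hw hwv => Set.ncard_pos (Set.toFinite _) |>.2 ⟨w, hw, hwv⟩
  by_cases hvi : S.comp i = v <;> by_cases hvj : S.comp j = v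
  · have : 1 < {i | S.comp i = v}.ncard :=
      (Set.one_lt_ncard_iff (Set.toFinite _)).2 ⟨i, j, hvi, hvj, hij⟩
    omega
  · obtain ⟨w, hw, hwv, -⟩ := h.below_right.exists_child hvj
    have := posA i hvi
    have := posB w hw hwv
    omega
  · obtain ⟨w, hw, hwv, -⟩ := h.below_left.exists_child hvi
    have := posA j hvj
    have := posB w hw hwv
    omega
  · obtain ⟨w, hw, hwv, hiw⟩ := h.below_left.exists_child hvi
    obtain ⟨w', hw', hwv', hjw⟩ := h.below_right.exists_child hvj
    have : 1 < {w | w ≠ S.root ∧ S.parent w = v}.ncard := by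
      refine (Set.one_lt_ncard_iff (Set.toFinite _)).2 ⟨w, w', ⟨hw, hwv⟩, ⟨hw', hwv'⟩, ?_⟩
      rintro rfl
      refine h.2.2 ?_
      rw [← hwv, special_parent hw hiw, special_parent hw hjw]
    omega

end NodalScaledLine

/-! ### Irreducible lines converging to a nodal line. -/

/-- The points `∞, z₁, …, zₙ` of the projective line. -/
noncomputable def configPoint {n : ℕ} (z : Fin n → ℂ) : Fin (n + 1) → OnePoint ℂ :=
  Fin.cases ∞ fun i => (z i : OnePoint ℂ)

/-- The coordinates of the irreducible line with markings `∞, z₁, …, zₙ` and volume form `dz`. -/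
noncomputable def configCrossRatios {n : ℕ} (z : Fin n → ℂ) : CrossRatioSpace n :=
  (fun q => crossRatio fun t => configPoint z (q t),
    fun p => (((z (p 1) - z (p 0))⁻¹ : ℂ) : OnePoint ℂ))

namespace NodalScaledLine

variable {n : ℕ}

/-- In the affine coordinates with centers `b v` and radii `e v` on the irreducible lines given by
`z`, the markings converge to the special points and the volume form converges to the volume form
of the component `v` of `S`. -/
structure IsLimit (S : NodalScaledLine n) {T : Type*} (l : Filter T) (z : T → Fin n → ℂ)
    (b e : S.V → T → ℂ) : Prop where
  radius_ne : ∀ v, ∀ᶠ t in l, e v t ≠ 0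
  tendsto_special : ∀ v i, Tendsto (fun t => (((z t i - b v t) / e v t : ℂ) : OnePoint ℂ)) l
    (𝓝 (S.special v i.succ))
  tendsto_scale : ∀ v, Tendsto (fun t => (e v t : OnePoint ℂ)) l (𝓝 (S.scale v))

variable {S : NodalScaledLine n} {T : Type*} {l : Filter T} {z : T → Fin n → ℂ}
  {b e : S.V → T → ℂ}

theorem IsLimit.tendsto_crossRatio (h : S.IsLimit l z b e) {q : Fin 4 → Fin (n + 1)} {v : S.V}
    (hq : 3 ≤ (Set.range fun t => S.special v (q t)).ncard) :
    Tendsto (fun t => crossRatio fun s => configPoint (z t) (q s)) l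
      (𝓝 (crossRatio fun t => S.special v (q t))) := by
  classical
  have hpt : ∀ i : Fin (n + 1), Tendsto (fun t => (configPoint (z t) i).map
      fun x => (x - b v t) / e v t) l (𝓝 (S.special v i)) := fun i => by
    cases i using Fin.cases with
    | zero => exact tendsto_const_nhds
    | succ i => exact h.tendsto_special v i
  refine (_root_.tendsto_crossRatio
    (f := fun t s => (configPoint (z t) (q s)).map fun x => (x - b v t) / e v t)
    (fun s => hpt (q s)) hq).congr' ?_
  filter_upwards [h.radius_ne v] with t ht
  have := crossRatio_map (affineMulAdd (e v t)⁻¹ (inv_ne_zero ht) (-(b v t) / e v t))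
    fun s => configPoint (z t) (q s)
  rw [← this]
  congr 2
  ext s
  congr 2
  ext x
  simp only [affineMulAdd_apply]
  ring

theorem IsLimit.tendsto_sub_div (h : S.IsLimit l z b e) {i j : Fin n} {v : S.V} {x y : ℂ}
    (hx : S.special v i.succ = x) (hy : S.special v j.succ = y) :
    Tendsto (fun t => (z t j - z t i) / e v t) l (𝓝 (y - x)) := by
  have h1 := h.tendsto_special v i
  have h2 := h.tendsto_special v j
  rw [hx, tendsto_coe_coe_iff] at h1
  rw [hy, tendsto_coe_coe_iff] at h2
  refine (h2.sub h1).congr fun t => ?_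
  ring

theorem IsLimit.eventually_ne (h : S.IsLimit l z b e) {i j : Fin n} (hij : i ≠ j) :
    ∀ᶠ t in l, z t i ≠ z t j := by
  obtain ⟨v, hv⟩ := S.exists_separates hij
  obtain ⟨x, y, hx, hy, hxy⟩ := hv.exists_coe
  filter_upwards [(h.tendsto_sub_div hx hy).eventually_ne (sub_ne_zero.2 hxy.symm)] with t ht hz
  simp [hz] at ht

/-- Up to the factor `e v t`, the difference `z t j - z t i` is a difference of rescaled points,
which tends to `y - x`. Homogeneous coordinates of the scale treat zero, finite and infinite limits
at once. -/
theorem IsLimit.tendsto_scaledRatio (h : S.IsLimit l z b e) {i j : Fin n} {v : S.V} {x y : ℂ}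
    (hx : S.special v i.succ = x) (hy : S.special v j.succ = y) (hxy : x ≠ y) :
    Tendsto (fun t => (((z t j - z t i)⁻¹ : ℂ) : OnePoint ℂ)) l
      (𝓝 (scaledRatio (S.scale v) x y)) := by
  obtain ⟨F, X, hF, hFe, hX⟩ := exists_isHomCoord_tendsto (h.tendsto_scale v)
  rw [scaledRatio_eq_of_isHomCoord hX hxy]
  have hd := h.tendsto_sub_div hx hy
  have hs : y - x ≠ 0 := sub_ne_zero.2 hxy.symm
  have hne : (X.2, X.1 * (y - x)) ≠ (0 : ℂ × ℂ) := by
    obtain ⟨a, ha, rfl⟩ := hX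
    cases S.scale v using OnePoint.rec <;> simp [ha, hs]
  refine ((continuousAt_projMk hne).tendsto.comp
    (hF.snd_nhds.prodMk_nhds (hF.fst_nhds.mul hd))).congr' ?_
  filter_upwards [hFe, h.radius_ne v, hd.eventually_ne hs] with t ht he hz
  obtain ⟨a, ha, hFt⟩ := ht
  have hz' : z t j - z t i ≠ 0 := fun h0 => hz (by rw [h0, zero_div])
  simp only [Function.comp, hFt, homCoord_coe, Prod.smul_mk, smul_eq_mul, projMk, mul_eq_zero, ha,
    he, hz, or_self, if_false]
  congr 1
  field_simp

/-- Whichever component the choice operator picks, its cross-ratio is the limit of the same family,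
so existence of one component is enough. -/
theorem IsLimit.tendsto_rho₄ (h : S.IsLimit l z b e) {q : Fin 4 → Fin (n + 1)}
    (hq : Function.Injective q) :
    Tendsto (fun t => crossRatio fun s => configPoint (z t) (q s)) l (𝓝 (S.rho₄ q)) := by
  have : ∃ w, ∃ v : S.V, 3 ≤ (Set.range fun t => S.special v (q t)).ncard ∧
      w = crossRatio fun t => S.special v (q t) := by
    obtain ⟨v, hv⟩ := S.exists_three_le_ncard hq
    exact ⟨_, v, hv, rfl⟩
  obtain ⟨v, hv, hw⟩ := Classical.epsilon_spec this
  rw [rho₄, hw]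
  exact h.tendsto_crossRatio hv

theorem IsLimit.tendsto_rho₂ (h : S.IsLimit l z b e) {i j : Fin n} (hij : i ≠ j) :
    Tendsto (fun t => (((z t j - z t i)⁻¹ : ℂ) : OnePoint ℂ)) l (𝓝 (S.rho₂ i j)) := by
  have : ∃ w, ∃ (v : S.V) (x y : ℂ),
      S.special v i.succ = (x : OnePoint ℂ) ∧ S.special v j.succ = (y : OnePoint ℂ) ∧ x ≠ y ∧
      w = scaledRatio (S.scale v) x y := by
    obtain ⟨v, hv⟩ := S.exists_separates hij
    obtain ⟨x, y, hx, hy, hxy⟩ := hv.exists_coe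
    exact ⟨_, v, x, y, hx, hy, hxy, rfl⟩
  obtain ⟨v, x, y, hx, hy, hxy, hw⟩ := Classical.epsilon_spec this
  rw [rho₂, hw]
  exact h.tendsto_scaledRatio hx hy hxy

theorem IsLimit.tendsto_crossRatios (h : S.IsLimit l z b e) :
    Tendsto (fun t => configCrossRatios (z t)) l (𝓝 S.crossRatios) := by
  refine Tendsto.prodMk_nhds (tendsto_pi_nhds.2 fun q => ?_) (tendsto_pi_nhds.2 fun p => ?_)
  · exact h.tendsto_rho₄ q.injective
  · exact h.tendsto_rho₂ (p.injective.ne (by decide))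

/-! ### Smoothing -/

variable (S)

open Classical in
/-- The order of the radius of the component `v` in the smoothing family. -/
noncomputable def radiusOrder (v : S.V) : ℤ :=
  if S.scale v = ((0 : ℂ) : OnePoint ℂ) then S.depth v
  -- Since depths lie between `1` and the number of components, this order is negative, and that of
  -- a zero form is positive.
  else if S.scale v = ∞ then S.depth v - Nat.card S.V - 1 else 0

open Classical in
/-- The leading coefficient of the radius of the component `v` in the smoothing family. -/
noncomputable def radiusCoeff (v : S.V) : ℂ :=
  if S.scale v = ((0 : ℂ) : OnePoint ℂ) then 1 else (S.scale v).elim 1 id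

/-- The radius of the component `v` in the smoothing family. -/
noncomputable def smoothingRadius (v : S.V) (t : ℂ) : ℂ := S.radiusCoeff v * t ^ S.radiusOrder v

open Classical in
/-- A family of irreducible lines that degenerates to `S` as `t` tends to zero. -/
noncomputable def smoothing (t : ℂ) (i : Fin n) : ℂ :=
  have := S.finite
  have := Fintype.ofFinite S.V
  -- Only the components on the path of `zᵢ` contribute: elsewhere the special point is `∞` and
  -- counts as `0`.
  ∑ v, S.smoothingRadius v t * (S.special v i.succ).elim 0 id

variable {S}

theorem depth_pos (v : S.V) : 0 < S.depth v := by
  have := S.finite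
  exact (Set.ncard_pos (Set.toFinite _)).2 ⟨v, Below.refl v⟩

theorem depth_le (v : S.V) : S.depth v ≤ Nat.card S.V := by
  have := S.finite
  rw [depth, ← Set.ncard_univ]
  exact Set.ncard_le_ncard (Set.subset_univ _) (Set.toFinite _)

/-- Towards the root the forms pass from zero through non-degenerate to infinite, that is, from
positive order through `0` to negative order. Within the zero and the infinite forms the depth
decides. -/
theorem Stable.radiusOrder_lt (hS : S.Stable) {u v : S.V} (h : S.Below u v) (hne : u ≠ v) :
    S.radiusOrder v < S.radiusOrder u := by
  have h1 := depth_lt h hne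
  have h2 := depth_pos u
  have h3 := depth_le v
  by_cases hv : S.scale v = ∞
  · simp only [radiusOrder, hv, OnePoint.infty_ne_coe, if_false, if_true]
    split_ifs <;> omega
  · have hu := hS.scale_eq_zero_of_below h hne hv
    simp only [radiusOrder, hu, hv, if_true, if_false]
    split_ifs <;> omega

theorem radiusCoeff_ne_zero (v : S.V) : S.radiusCoeff v ≠ 0 := by
  rw [radiusCoeff]
  split_ifs with h
  · exact one_ne_zero
  · cases hv : S.scale v using OnePoint.rec with
    | infty => exact one_ne_zero
    | coe c =>
      rw [hv, OnePoint.coe_eq_coe] at h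
      exact h

theorem smoothingRadius_ne_zero (v : S.V) {t : ℂ} (ht : t ≠ 0) : S.smoothingRadius v t ≠ 0 :=
  mul_ne_zero (radiusCoeff_ne_zero v) (zpow_ne_zero _ ht)

theorem tendsto_smoothingRadius (v : S.V) :
    Tendsto (fun t => (S.smoothingRadius v t : OnePoint ℂ)) (𝓝[≠] 0) (𝓝 (S.scale v)) := by
  have hd := depth_pos v
  have hd' := depth_le v
  by_cases h0 : S.scale v = ((0 : ℂ) : OnePoint ℂ)
  · rw [h0, tendsto_coe_coe_iff]
    unfold smoothingRadius radiusCoeff radiusOrder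
    simp only [h0, if_true, one_mul, zpow_natCast]
    have : ContinuousAt (fun t : ℂ => t ^ S.depth v) 0 := by fun_prop
    have := this.tendsto
    rw [zero_pow hd.ne'] at this
    exact this.mono_left nhdsWithin_le_nhds
  · by_cases h1 : S.scale v = ∞
    · rw [h1, tendsto_coe_infty_iff]
      simp only [smoothingRadius, radiusCoeff, radiusOrder, h1, if_true, OnePoint.infty_ne_coe,
        if_false, OnePoint.elim_infty, one_mul]
      exact tendsto_norm_cobounded_atTop.comp
        (tendsto_zpow_nhdsNE_zero_cobounded (by omega))
    · obtain ⟨c, hc⟩ := OnePoint.ne_infty_iff_exists.1 h1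
      refine tendsto_const_nhds.congr fun t => ?_
      simp only [smoothingRadius, radiusCoeff, radiusOrder, h0, h1, if_false, zpow_zero, mul_one]
      rw [← hc]
      rfl

theorem Stable.tendsto_smoothingRadius_div (hS : S.Stable) {u v : S.V} (h : S.Below u v)
    (hne : u ≠ v) :
    Tendsto (fun t => S.smoothingRadius u t / S.smoothingRadius v t) (𝓝[≠] 0) (𝓝 0) := by
  have h1 := hS.radiusOrder_lt h hne
  obtain ⟨k, hk⟩ := Int.eq_ofNat_of_zero_le (sub_nonneg.2 h1.le)
  have : ContinuousAt (fun t : ℂ => S.radiusCoeff u / S.radiusCoeff v * t ^ k) 0 := by fun_prop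
  have := this.tendsto
  rw [zero_pow (by omega), mul_zero] at this
  refine (this.mono_left nhdsWithin_le_nhds).congr' ?_
  filter_upwards [self_mem_nhdsWithin] with t ht
  have ht : t ≠ 0 := ht
  rw [← zpow_natCast, ← hk, zpow_sub₀ ht]
  simp only [smoothingRadius]
  rw [div_mul_div_comm]

/-- In the sum over components `u`, the term of `v` gives `x - y`. Terms strictly above `v` cancel,
as both markings have the same special point there. Terms strictly below have radius `o(e v)`.
Components incomparable with `v` are on neither path. -/
theorem Stable.tendsto_smoothing_sub_div (hS : S.Stable) {v : S.V} {i k : Fin n} {x y : ℂ}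
    (hx : S.special v i.succ = x) (hy : S.special v k.succ = y) :
    Tendsto (fun t => (S.smoothing t i - S.smoothing t k) / S.smoothingRadius v t) (𝓝[≠] 0)
      (𝓝 (x - y)) := by
  classical
  have := S.finite
  have := Fintype.ofFinite S.V
  have hi : S.Below (S.comp i) v := special_ne_infty_iff.1 (by rw [hx]; exact OnePoint.coe_ne_infty _)
  have hk : S.Below (S.comp k) v := special_ne_infty_iff.1 (by rw [hy]; exact OnePoint.coe_ne_infty _)
  have hsum : ∀ t, (S.smoothing t i - S.smoothing t k) / S.smoothingRadius v t =
      ∑ u, S.smoothingRadius u t / S.smoothingRadius v t *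
        ((S.special u i.succ).elim 0 id - (S.special u k.succ).elim 0 id) := fun t => by
    have h1 : ∀ j, S.smoothing t j =
        ∑ u, S.smoothingRadius u t * (S.special u j.succ).elim 0 id := fun j => by
      simp only [smoothing]
      congr!
    rw [h1, h1, ← Finset.sum_sub_distrib, Finset.sum_div]
    refine Finset.sum_congr rfl fun u _ => ?_
    ring
  simp only [hsum]
  have : (x - y : ℂ) = ∑ u : S.V, if u = v then x - y else 0 := by simp
  rw [this]
  refine tendsto_finsetSum _ fun u _ => ?_
  split_ifs with huv
  · subst huv
    refine tendsto_const_nhds.congr' ?_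
    filter_upwards [self_mem_nhdsWithin] with t ht
    rw [div_self (smoothingRadius_ne_zero u ht), hx, hy, one_mul]
    rfl
  · have hlt : ∀ j, S.Below (S.comp j) v → S.Below (S.comp j) u → S.Below v u ∨
        Tendsto (fun t => S.smoothingRadius u t / S.smoothingRadius v t) (𝓝[≠] 0) (𝓝 0) :=
      fun j h1 h2 => (h1.total h2).imp_right fun h => hS.tendsto_smoothingRadius_div h huv
    have hfin : Tendsto (fun t => S.smoothingRadius u t / S.smoothingRadius v t) (𝓝[≠] 0) (𝓝 0) →
        Tendsto (fun t => S.smoothingRadius u t / S.smoothingRadius v t *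
        ((S.special u i.succ).elim 0 id - (S.special u k.succ).elim 0 id)) (𝓝[≠] 0) (𝓝 0) :=
      fun h => by simpa using h.mul_const _
    have hzero : S.special u i.succ = S.special u k.succ →
        Tendsto (fun t => S.smoothingRadius u t / S.smoothingRadius v t *
        ((S.special u i.succ).elim 0 id - (S.special u k.succ).elim 0 id)) (𝓝[≠] 0) (𝓝 0) :=
      fun h => by simp [h]
    by_cases hvu : S.Below v u
    · exact hzero (special_eq_of_below hvu (Ne.symm huv) hi hk)
    by_cases h1 : S.Below (S.comp i) u
    · exact hfin ((hlt i hi h1).resolve_left hvu)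
    by_cases h2 : S.Below (S.comp k) u
    · exact hfin ((hlt k hk h2).resolve_left hvu)
    · exact hzero (by rw [special_succ_of_not_below h1, special_succ_of_not_below h2])

theorem Stable.exists_isLimit (hS : S.Stable) :
    ∃ b e : S.V → ℂ → ℂ, S.IsLimit (𝓝[≠] 0) S.smoothing b e := by
  choose k hk using hS.exists_below
  choose y hy using fun v => OnePoint.ne_infty_iff_exists.1 (special_ne_infty_iff.2 (hk v))
  -- The centre is chosen so that the reference marking `k v` sits near its special point `y v` in
  -- the coordinate of `v`.
  refine ⟨fun v t => S.smoothing t (k v) - S.smoothingRadius v t * y v, S.smoothingRadius, ?_, ?_,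
    tendsto_smoothingRadius⟩
  · intro v
    filter_upwards [self_mem_nhdsWithin] with t ht
    exact smoothingRadius_ne_zero v ht
  · intro v i
    have hcongr : ∀ᶠ t in 𝓝[≠] (0 : ℂ),
        (S.smoothing t i - S.smoothing t (k v)) / S.smoothingRadius v t + y v =
        (S.smoothing t i - (S.smoothing t (k v) - S.smoothingRadius v t * y v)) /
          S.smoothingRadius v t := by
      filter_upwards [self_mem_nhdsWithin] with t ht
      have := smoothingRadius_ne_zero v ht
      field_simp
      ring
    by_cases hi : S.Below (S.comp i) v
    · obtain ⟨x, hx⟩ := OnePoint.ne_infty_iff_exists.1 (special_ne_infty_iff.2 hi)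
      rw [← hx, tendsto_coe_coe_iff]
      have := (hS.tendsto_smoothing_sub_div hx.symm (hy v).symm).add_const (y v)
      rw [sub_add_cancel] at this
      exact this.congr' hcongr
    · rw [special_succ_of_not_below hi, tendsto_coe_infty_iff]
      have hik : i ≠ k v := by
        rintro rfl
        exact hi (hk v)
      -- A marking outside `v` is separated from `k v` at a component `u` strictly above `v`. Their
      -- distance is of the order of the radius of `u`, which dominates that of `v`.
      obtain ⟨u, hu⟩ := S.exists_separates hik
      obtain ⟨x, x', hx, hx', hxx⟩ := hu.exists_coe
      have hvu : S.Below v u := by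
        rcases (hk v).total hu.below_right with h | h
        · exact h
        · exact absurd (hu.below_left.trans h) hi
      have hne : v ≠ u := by
        rintro rfl
        exact hi hu.below_left
      have h1 := hS.tendsto_smoothing_sub_div hx hx'
      have h2 := (hS.tendsto_smoothingRadius_div hvu hne).mul (h1.inv₀ (sub_ne_zero.2 hxx))
      rw [zero_mul] at h2
      have h3 : Tendsto (fun t => (S.smoothing t i - S.smoothing t (k v)) / S.smoothingRadius v t)
          (𝓝[≠] 0) (Bornology.cobounded ℂ) := by
        have h4 : Tendsto (fun t => S.smoothingRadius v t / S.smoothingRadius u t *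
            ((S.smoothing t i - S.smoothing t (k v)) / S.smoothingRadius u t)⁻¹) (𝓝[≠] 0)
            (𝓝[≠] 0) := by
          refine tendsto_nhdsWithin_iff.2 ⟨h2, ?_⟩
          filter_upwards [self_mem_nhdsWithin, h1.eventually_ne (sub_ne_zero.2 hxx)] with t ht ht'
          exact mul_ne_zero (div_ne_zero (smoothingRadius_ne_zero v ht)
            (smoothingRadius_ne_zero u ht)) (inv_ne_zero ht')
        refine (tendsto_inv₀_nhdsNE_zero.comp h4).congr' ?_
        filter_upwards [self_mem_nhdsWithin, h1.eventually_ne (sub_ne_zero.2 hxx)] with t ht ht'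
        have e1 := smoothingRadius_ne_zero v ht
        have e2 := smoothingRadius_ne_zero u ht
        simp only [Function.comp]
        field_simp
      have h5 := tendsto_norm_cobounded_atTop.comp
        ((tendsto_add_const_cobounded (y v)).comp h3)
      exact h5.congr' (hcongr.mono fun t ht => congrArg norm ht)

end NodalScaledLine

/-! ### The coordinates determine a stable line up to isomorphism. -/

theorem exists_affineEquiv {x y x' y' : ℂ} (h : x ≠ y) (h' : x' ≠ y') :
    ∃ g : ℂ ≃ᵃ[ℂ] ℂ, g x = x' ∧ g y = y' := by
  have h1 : y - x ≠ 0 := sub_ne_zero.2 h.symm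
  have h2 : y' - x' ≠ 0 := sub_ne_zero.2 h'.symm
  refine ⟨affineMulAdd ((y' - x') / (y - x)) (div_ne_zero h2 h1)
    (x' - (y' - x') / (y - x) * x), ?_, ?_⟩
  · simp
  · rw [affineMulAdd_apply]
    field_simp
    ring

theorem scaledRatio_injective {x y : ℂ} (h : x ≠ y) {c c' : OnePoint ℂ}
    (hc : scaledRatio c x y = scaledRatio c' x y) : c = c' := by
  have h1 : y - x ≠ 0 := sub_ne_zero.2 h.symm
  cases c using OnePoint.rec with
  | infty =>
    cases c' using OnePoint.rec with
    | infty => rfl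
    | coe c' =>
      by_cases h' : c' = 0 <;> simp [scaledRatio, h', h1, eq_comm] at hc
  | coe c =>
    cases c' using OnePoint.rec with
    | infty => by_cases h' : c = 0 <;> simp [scaledRatio, h', h1] at hc
    | coe c' =>
      by_cases h' : c = 0 <;> by_cases h'' : c' = 0
      · rw [h', h'']
      · simp [scaledRatio, h', h''] at hc
      · simp [scaledRatio, h', h''] at hc
      · simp only [scaledRatio, OnePoint.elim_some, h', h'', if_false, OnePoint.coe_eq_coe,
          inv_inj, mul_eq_mul_right_iff, h1, or_false] at hc
        rw [hc]

namespace NodalScaledLine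

variable {n : ℕ} {S T : NodalScaledLine n}

/-- Both sides are limits of one smoothing family, so the value is independent of the component. -/
theorem Stable.rho₄_eq (hS : S.Stable) {q : Fin 4 → Fin (n + 1)} (hq : Function.Injective q)
    {v : S.V} (hv : 3 ≤ (Set.range fun t => S.special v (q t)).ncard) :
    S.rho₄ q = crossRatio fun t => S.special v (q t) := by
  obtain ⟨b, e, h⟩ := hS.exists_isLimit
  exact tendsto_nhds_unique (h.tendsto_rho₄ hq) (h.tendsto_crossRatio hv)

theorem Stable.rho₂_eq (hS : S.Stable) {i j : Fin n} {v : S.V} {x y : ℂ}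
    (hx : S.special v i.succ = x) (hy : S.special v j.succ = y) (hxy : x ≠ y) :
    S.rho₂ i j = scaledRatio (S.scale v) x y := by
  obtain ⟨b, e, h⟩ := hS.exists_isLimit
  have hij : i ≠ j := by
    rintro rfl
    exact hxy (OnePoint.coe_injective (hx.symm.trans hy))
  exact tendsto_nhds_unique (h.tendsto_rho₂ hij) (h.tendsto_scaledRatio hx hy hxy)

/-- The affine map `g` from the component `v` of `S` to the component `w` of `T` preserves special
points and volume forms. -/
structure Matches (S T : NodalScaledLine n) (v : S.V) (w : T.V) (g : ℂ ≃ᵃ[ℂ] ℂ) : Prop where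
  special : ∀ k, T.special w k = OnePoint.map g (S.special v k)
  scale : S.scale v = OnePoint.map (fun c => c * g.linear 1) (T.scale w)

variable {v : S.V} {w : T.V} {g : ℂ ≃ᵃ[ℂ] ℂ}

theorem affineEquiv_linear_mul_symm (g : ℂ ≃ᵃ[ℂ] ℂ) : g.linear 1 * g.symm.linear 1 = 1 := by
  have h1 := affineEquiv_sub g.symm (g 1) (g 0)
  rw [AffineEquiv.symm_apply_apply, AffineEquiv.symm_apply_apply, affineEquiv_sub] at h1
  linear_combination -h1

theorem Matches.symm (h : Matches S T v w g) : Matches T S w v g.symm where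
  special k := by
    rw [h.special]
    cases S.special v k using OnePoint.rec <;> simp
  scale := by
    rw [h.scale]
    cases T.scale w using OnePoint.rec with
    | infty => rfl
    | coe c => simp only [OnePoint.map_some, mul_assoc, affineEquiv_linear_mul_symm, mul_one]

theorem Matches.injective (_ : Matches S T v w g) : Function.Injective (OnePoint.map g) :=
  Option.map_injective g.injective

theorem Matches.special_eq_infty (h : Matches S T v w g) (k : Fin (n + 1)) :
    T.special w k = ∞ ↔ S.special v k = ∞ := by
  rw [h.special]
  exact ⟨fun h' => h.injective (h'.trans (OnePoint.map_infty g).symm), fun h' => by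
    rw [h', OnePoint.map_infty]⟩

theorem Matches.below_iff (h : Matches S T v w g) (i : Fin n) :
    T.Below (T.comp i) w ↔ S.Below (S.comp i) v := by
  rw [← special_ne_infty_iff, ← special_ne_infty_iff, Ne, h.special_eq_infty]

theorem Matches.special_eq_special (h : Matches S T v w g) (k l : Fin (n + 1)) :
    T.special w k = T.special w l ↔ S.special v k = S.special v l := by
  rw [h.special, h.special, h.injective.eq_iff]

theorem Matches.separates_iff (h : Matches S T v w g) (i j : Fin n) :
    T.Separates w i j ↔ S.Separates v i j := by
  simp only [Separates, Ne, h.special_eq_infty, h.special_eq_special]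

theorem Matches.scale_eq_infty (h : Matches S T v w g) : S.scale v = ∞ ↔ T.scale w = ∞ := by
  rw [h.scale]
  cases T.scale w using OnePoint.rec <;> simp

theorem Matches.scale_eq_zero (h : Matches S T v w g) :
    S.scale v = ((0 : ℂ) : OnePoint ℂ) ↔ T.scale w = ((0 : ℂ) : OnePoint ℂ) := by
  rw [h.scale]
  have := affineEquiv_linear_ne_zero g
  cases T.scale w using OnePoint.rec <;> simp [this]

theorem Stable.eq_of_nondegenerate (hS : S.Stable) {u v : S.V} {i : Fin n}
    (hu : S.Below (S.comp i) u) (hv : S.Below (S.comp i) v) (hu' : ¬ S.Degenerate u)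
    (hv' : ¬ S.Degenerate v) : u = v := by
  by_contra hne
  simp only [Degenerate, not_or] at hu' hv'
  rcases hu.total hv with h | h
  · exact hu'.1 (hS.scale_eq_zero_of_below h hne hv'.2)
  · exact hv'.1 (hS.scale_eq_zero_of_below h (Ne.symm hne) hu'.2)

/-- A pair separated on the component pins it down. Without such a pair it is non-degenerate, and
the path of a marking contains only one non-degenerate component. -/
theorem Matches.unique (hT : T.Stable) {w' : T.V} {g' : ℂ ≃ᵃ[ℂ] ℂ} (h : Matches S T v w g)
    (h' : Matches S T v w' g') : w = w' := by
  by_cases hw : ∃ i j, T.Separates w i j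
  · obtain ⟨i, j, hij⟩ := hw
    exact hij.unique ((h'.separates_iff i j).2 ((h.separates_iff i j).1 hij))
  · have h1 : ¬ T.Degenerate w := fun hd => hw (hT.exists_separates_of_degenerate hd)
    have h2 : ¬ T.Degenerate w' := by
      rw [Degenerate, ← h'.scale_eq_infty, ← h'.scale_eq_zero, h.scale_eq_infty, h.scale_eq_zero]
      exact h1
    obtain ⟨i, hi⟩ := hT.exists_below w
    exact hT.eq_of_nondegenerate hi ((h'.below_iff i).2 ((h.below_iff i).1 hi)) h1 h2

/-- The affine map is fixed by the special points of `zᵢ` and `zⱼ`. The cross-ratio with `z₀, zᵢ,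
zⱼ` then forces every other special point, and `ρ_{ij}` forces the form. -/
theorem exists_matches_of_separates (hS : S.Stable) (hT : T.Stable)
    (hc : S.crossRatios = T.crossRatios) {i j : Fin n} (hv : S.Separates v i j)
    (hw : T.Separates w i j) : ∃ g, Matches S T v w g := by
  wlog hij : i < j generalizing i j
  · refine this hv.symm hw.symm (lt_of_le_of_ne (not_lt.1 hij) ?_)
    rintro rfl
    exact hv.2.2 rfl
  obtain ⟨x, y, hx, hy, hxy⟩ := hv.exists_coe
  obtain ⟨x', y', hx', hy', hxy'⟩ := hw.exists_coe
  obtain ⟨g, rfl, rfl⟩ := exists_affineEquiv hxy hxy'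
  refine ⟨g, ?_, ?_⟩
  · intro k
    cases k using Fin.cases with
    | zero => rfl
    | succ k =>
    by_cases hki : k = i
    · rw [hki, hx, hx', OnePoint.map_some]
    by_cases hkj : k = j
    · rw [hkj, hy, hy', OnePoint.map_some]
    -- Coordinates exist only for increasing quadruples, so the four indices are sorted and their
    -- positions `t, t0, ti, tj` recovered.
    let A : Finset (Fin (n + 1)) := {k.succ, 0, i.succ, j.succ}
    have hA : A.card = 4 := by
      simp only [A]
      rw [Finset.card_insert_of_notMem, Finset.card_insert_of_notMem, Finset.card_pair] <;>
        simp [hki, hkj, hij.ne, (Fin.succ_ne_zero _).symm]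
    have hr := Finset.range_orderEmbOfFin A hA
    set q := A.orderEmbOfFin hA with hq
    have hmem : ∀ a ∈ A, ∃ t, q t = a := fun a ha => by
      have : a ∈ Set.range q := hr ▸ ha
      exact this
    obtain ⟨t, ht⟩ := hmem k.succ (by simp [A])
    obtain ⟨t0, ht0⟩ := hmem 0 (by simp [A])
    obtain ⟨ti, hti⟩ := hmem i.succ (by simp [A])
    obtain ⟨tj, htj⟩ := hmem j.succ (by simp [A])
    have hSq : S.rho₄ q = crossRatio fun t => S.special v (q t) := by
      refine hS.rho₄_eq q.injective
        (three_le_ncard_range (w := fun t => S.special v (q t)) (s := t0) (t := ti) (u := tj) ?_ ?_ ?_)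
      · rw [ht0, hti]; exact hv.1.symm
      · rw [ht0, htj]; exact hv.2.1.symm
      · rw [hti, htj]; exact hv.2.2
    have hTq : T.rho₄ q = crossRatio fun t => T.special w (q t) := by
      refine hT.rho₄_eq q.injective
        (three_le_ncard_range (w := fun t => T.special w (q t)) (s := t0) (t := ti) (u := tj) ?_ ?_ ?_)
      · rw [ht0, hti]; exact hw.1.symm
      · rw [ht0, htj]; exact hw.2.1.symm
      · rw [hti, htj]; exact hw.2.2
    have hST : S.rho₄ q = T.rho₄ q := congrFun (congrArg Prod.fst hc) q
    rw [hSq, hTq, ← crossRatio_map g] at hST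
    have hcases : ∀ s, s ≠ t → s = t0 ∨ s = ti ∨ s = tj := fun s hs => by
      have : q s ∈ Set.range q := ⟨s, rfl⟩
      rw [hr] at this
      simp only [A, Finset.coe_insert, Finset.coe_singleton, Set.mem_insert_iff,
        Set.mem_singleton_iff, ← ht, ← ht0, ← hti, ← htj, q.injective.eq_iff] at this
      exact this.resolve_left hs
    have hginj : Function.Injective (OnePoint.map g) := Option.map_injective g.injective
    have := crossRatio_injective_of_eq (s := t) ?_ ?_ hST.symm
    · rwa [ht] at this
    · intro s hs
      rcases hcases s hs with rfl | rfl | rfl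
      · rw [ht0]; rfl
      · rw [hti, hx, hx', OnePoint.map_some]
      · rw [htj, hy, hy', OnePoint.map_some]
    · intro s u hs hu hsu
      rcases hcases s hs with rfl | rfl | rfl <;> rcases hcases u hu with rfl | rfl | rfl <;>
        simp only [ht0, hti, htj, special_zero] <;>
        first
        | exact absurd rfl hsu
        | exact hw.1
        | exact hw.2.1
        | exact hw.1.symm
        | exact hw.2.1.symm
        | exact hw.2.2
        | exact hw.2.2.symm
  · have hmono : StrictMono ![i, j] := by
      rw [Fin.strictMono_iff_lt_succ]
      intro a
      fin_cases a
      exact hij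
    have hST : S.rho₂ i j = T.rho₂ i j :=
      congrFun (congrArg Prod.snd hc) (OrderEmbedding.ofStrictMono ![i, j] hmono)
    rw [hS.rho₂_eq hx hy hxy, hT.rho₂_eq hx' hy' hxy', ← scaledRatio_map] at hST
    exact scaledRatio_injective hxy hST

/-- A component separating no pair is non-degenerate and has a single finite special point; it is
matched with the non-degenerate component `w` on the path of the same marking. Whether another `zₖ`
lies beyond it is read off from the component separating `zᵢ` and `zₖ`: beyond if that form is zero,
outside if it is infinite. -/
theorem exists_matches (hS : S.Stable) (hT : T.Stable) (hc : S.crossRatios = T.crossRatios)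
    (v : S.V) : ∃ w g, Matches S T v w g := by
  by_cases hv : ∃ i j, S.Separates v i j
  · obtain ⟨i, j, hij⟩ := hv
    have hne : i ≠ j := by
      rintro rfl
      exact hij.2.2 rfl
    obtain ⟨w, hw⟩ := T.exists_separates hne
    exact ⟨w, exists_matches_of_separates hS hT hc hij hw⟩
  have hvn : ¬ S.Degenerate v := fun hd => hv (hS.exists_separates_of_degenerate hd)
  have hvn' := hvn
  simp only [Degenerate, not_or] at hvn'
  obtain ⟨i, hi⟩ := hS.exists_below v
  obtain ⟨w, hiw, hwn, -, -⟩ := T.exists_nondegenerate i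
  obtain ⟨x, hx⟩ := OnePoint.ne_infty_iff_exists.1 (special_ne_infty_iff.2 hi)
  obtain ⟨x', hx'⟩ := OnePoint.ne_infty_iff_exists.1 (special_ne_infty_iff.2 hiw)
  obtain ⟨c, hcv⟩ := OnePoint.ne_infty_iff_exists.1 hvn'.2
  obtain ⟨c', hcw⟩ := OnePoint.ne_infty_iff_exists.1 hwn.2
  have hc0 : c ≠ 0 := by
    rintro rfl
    exact hvn'.1 hcv.symm
  have hc0' : c' ≠ 0 := by
    rintro rfl
    exact hwn.1 hcw.symm
  -- The slope is dictated by the volume forms and the translation by `x ↦ x'`.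
  refine ⟨w, affineMulAdd (c / c') (div_ne_zero hc0 hc0') (x' - c / c' * x), ?_, ?_⟩
  · intro k
    cases k using Fin.cases with
    | zero => rfl
    | succ k =>
    by_cases hki : i = k
    · rw [← hki, ← hx, ← hx', OnePoint.map_some, affineMulAdd_apply]
      congr 1
      ring
    obtain ⟨u, hu⟩ := S.exists_separates hki
    obtain ⟨u', hu'⟩ := T.exists_separates hki
    obtain ⟨g, hg⟩ := exists_matches_of_separates hS hT hc hu hu'
    by_cases hk : S.Below (S.comp k) v
    · have hk' : S.special v k.succ = S.special v i.succ := by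
        by_contra hne
        exact hv ⟨k, i, special_ne_infty_iff.2 hk, special_ne_infty_iff.2 hi, hne⟩
      have huv : S.Below u v := by
        rcases hu.below_left.total hi with h | h
        · exact h
        · rw [hu.eq_of_below h hi hk]; exact Below.refl _
      have hne : u ≠ v := by
        rintro rfl
        exact hv ⟨_, _, hu⟩
      have hs := hg.scale_eq_zero.1 (hS.scale_eq_zero_of_below huv hne hvn'.2)
      have hne' : u' ≠ w := by
        rintro rfl
        exact hwn.1 hs
      have huw : T.Below u' w := by
        rcases hu'.below_left.total hiw with h | h
        · exact h
        · have := hT.scale_eq_infty_of_below h hne'.symm hwn.1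
          rw [hs] at this
          exact absurd this (OnePoint.coe_ne_infty _)
      rw [hk', ← hx, special_eq_of_below huw hne' hu'.below_right hu'.below_left, ← hx',
        OnePoint.map_some, affineMulAdd_apply]
      congr 1
      ring
    · have hvu : S.Below v u := by
        rcases hu.below_left.total hi with h | h
        · exact absurd (hu.below_right.trans h) hk
        · exact h
      have hne : v ≠ u := by
        rintro rfl
        exact hv ⟨_, _, hu⟩
      have hs := hg.scale_eq_infty.1 (hS.scale_eq_infty_of_below hvu hne hvn'.1)
      have hne' : u' ≠ w := by
        rintro rfl
        exact hwn.2 hs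
      have hwk : ¬ T.Below (T.comp k) w := fun hkw => by
        rcases hu'.below_left.total hiw with h | h
        · have := hT.scale_eq_zero_of_below h hne' hwn.2
          rw [hs] at this
          exact absurd this (OnePoint.infty_ne_coe _)
        · exact hne' (hu'.eq_of_below h hiw hkw).symm
      rw [special_succ_of_not_below hk, special_succ_of_not_below hwk, OnePoint.map_infty]
  · rw [← hcv, ← hcw, OnePoint.map_some, affineMulAdd_linear]
    congr 1
    field_simp

/-- This expresses the tree order by special points alone, which matches preserve. Conversely, if
`v` were strictly below `u`, a pair separated at either component would contradict the condition; so
both would be non-degenerate on one path, hence equal. -/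
theorem Stable.below_iff (hS : S.Stable) {u v : S.V} (hne : u ≠ v) : S.Below u v ↔
    ∀ i j, S.Below (S.comp i) u → S.Below (S.comp j) u →
      S.Below (S.comp i) v ∧ S.special v i.succ = S.special v j.succ := by
  refine ⟨fun h i j hi hj => ⟨hi.trans h, special_eq_of_below h hne hi hj⟩, fun h => ?_⟩
  obtain ⟨i, hi⟩ := hS.exists_below u
  refine (hi.total (h i i hi hi).1).resolve_right fun hvu => ?_
  have hu : ¬ S.Degenerate u := fun hd => by
    obtain ⟨j, k, hjk⟩ := hS.exists_separates_of_degenerate hd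
    have h1 := h j k hjk.below_left hjk.below_right
    have h2 := h k j hjk.below_right hjk.below_left
    exact hne (hjk.eq_of_below hvu h1.1 h2.1).symm
  have hv : ¬ S.Degenerate v := fun hd => by
    obtain ⟨j, k, hjk⟩ := hS.exists_separates_of_degenerate hd
    exact hjk.2.2 (h j k (hjk.below_left.trans hvu) (hjk.below_right.trans hvu)).2
  exact hne (hS.eq_of_nondegenerate hi (h i i hi hi).1 hu hv)

/-- Matching is a bijection of components that preserves the tree order. The root is the greatest
element, the parent the least one strictly above, and `comp i` the least one containing `zᵢ`, so all
of these are preserved. -/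
theorem nonempty_iso_of_crossRatios_eq (hS : S.Stable) (hT : T.Stable)
    (hc : S.crossRatios = T.crossRatios) : Nonempty (Iso S T) := by
  choose f g hfg using exists_matches hS hT hc
  have hinj : Function.Injective f := fun u v huv =>
    (hfg u).symm.unique hS (huv ▸ (hfg v).symm)
  have hsurj : Function.Surjective f := fun w => by
    obtain ⟨v, g', h⟩ := exists_matches hT hS hc.symm w
    exact ⟨v, (hfg v).unique hT h.symm⟩
  have hbelow : ∀ u v, T.Below (f u) (f v) ↔ S.Below u v := fun u v => by
    by_cases huv : u = v
    · rw [huv]; exact iff_of_true (Below.refl _) (Below.refl _)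
    · rw [hS.below_iff huv, hT.below_iff (hinj.ne huv)]
      simp only [(hfg _).below_iff, (hfg _).special_eq_special]
  have hroot : f S.root = T.root := by
    obtain ⟨v, hv⟩ := hsurj T.root
    have := (hbelow v S.root).2 (below_root v)
    rw [hv] at this
    exact (below_root _).antisymm this
  have hparent : ∀ v, f (S.parent v) = T.parent (f v) := fun v => by
    by_cases hv : v = S.root
    · rw [hv, S.parent_root, hroot, T.parent_root]
    · have hfv : f v ≠ T.root := hroot ▸ hinj.ne hv
      obtain ⟨p, hp⟩ := hsurj (T.parent (f v))
      have h1 : S.Below v p := (hbelow v p).1 (hp ▸ below_parent _)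
      have h2 : v ≠ p := by
        rintro rfl
        exact parent_ne hfv hp.symm
      refine Below.antisymm (hp ▸ (hbelow _ _).2 (h1.parent_below h2)) ?_
      exact ((hbelow _ _).2 (below_parent v)).parent_below (hinj.ne (parent_ne hv).symm)
  have hcomp : ∀ i, T.comp i = f (S.comp i) := fun i => by
    obtain ⟨v, hv⟩ := hsurj (T.comp i)
    have h1 : S.Below (S.comp i) v := ((hfg v).below_iff i).1 (hv ▸ Below.refl _)
    exact (((hfg (S.comp i)).below_iff i).2 (Below.refl _)).antisymm (hv ▸ (hbelow _ _).2 h1)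
  refine ⟨⟨Equiv.ofBijective f ⟨hinj, hsurj⟩, g, hroot, hparent, ?_, hcomp, ?_,
    fun v => (hfg v).scale⟩⟩
  · intro v hv
    obtain ⟨i, hi⟩ := hS.exists_below v
    have h1 := special_parent hv hi
    have h2 := special_parent (S := T) (w := f v) (hroot ▸ hinj.ne hv) (((hfg v).below_iff i).2 hi)
    rw [← hparent, (hfg _).special, h1, OnePoint.map_some, OnePoint.coe_eq_coe] at h2
    exact h2.symm
  · intro i
    have h1 := T.special_comp i
    rw [hcomp, (hfg _).special, special_comp, OnePoint.map_some, OnePoint.coe_eq_coe] at h1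
    exact h1.symm

end NodalScaledLine

/-! ### The open variety as the space of configurations. -/

section Config

variable {n : ℕ}

theorem configPoint_injective {z : Fin n → ℂ} (hz : Function.Injective z) :
    Function.Injective (configPoint z) := by
  intro i j h
  cases i using Fin.cases <;> cases j using Fin.cases
  · rfl
  · exact absurd h (OnePoint.infty_ne_coe _)
  · exact absurd h (OnePoint.coe_ne_infty _)
  · exact congrArg Fin.succ (hz (OnePoint.coe_injective h))

/-- The cross-ratios of `∞, z₁, …, zₙ` as complex numbers. -/
noncomputable def configRatio (z : Fin n → ℂ) (i j k l : Fin (n + 1)) : ℂ :=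
  homDet (configPoint z j) (configPoint z k) * homDet (configPoint z l) (configPoint z i) /
    (homDet (configPoint z i) (configPoint z j) * homDet (configPoint z k) (configPoint z l))

theorem crossRatio_configPoint {z : Fin n → ℂ} (hz : Function.Injective z)
    {q : Fin 4 → Fin (n + 1)} (hq : Function.Injective q) :
    crossRatio (fun t => configPoint z (q t)) = (configRatio z (q 0) (q 1) (q 2) (q 3) : ℂ) := by
  have hd : ∀ s t : Fin 4, s ≠ t → homDet (configPoint z (q s)) (configPoint z (q t)) ≠ 0 :=
    fun s t hst h => hst (hq (configPoint_injective hz (homDet_eq_zero.1 h)))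
  rw [crossRatio, if_neg (mul_ne_zero (hd 0 1 (by decide)) (hd 2 3 (by decide)))]
  rfl

theorem isCrossRatioSystem_config {z : Fin n → ℂ} (hz : Function.Injective z) :
    IsCrossRatioSystem (configRatio z) fun i j => (z j - z i)⁻¹ := by
  have hd : ∀ i j, i ≠ j → homDet (configPoint z i) (configPoint z j) ≠ 0 :=
    fun s t hst h => hst (configPoint_injective hz (homDet_eq_zero.1 h))
  have hz' : ∀ i j, i ≠ j → z j - z i ≠ 0 := fun i j h => sub_ne_zero.2 (hz.ne h.symm)
  refine ⟨?_, ?_, ?_, ?_, ?_, ?_, ?_, ?_⟩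
  · intro i j k l h
    simp only [List.nodup_cons, List.mem_cons, List.not_mem_nil, or_false, not_or, not_false_eq_true,
      List.nodup_nil, and_true] at h
    obtain ⟨⟨hij, hik, hil⟩, ⟨hjk, hjl⟩, hkl⟩ := h
    have d1 := hd i j hij
    have d2 := hd k l hkl
    refine ⟨div_ne_zero (mul_ne_zero (hd _ _ hjk) (hd _ _ (Ne.symm hil))) (mul_ne_zero d1 d2), ?_⟩
    rw [configRatio, Ne, div_eq_one_iff_eq (mul_ne_zero d1 d2)]
    intro h
    -- By the Plücker relation, cross-ratio `1` would make this product of determinants vanish.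
    refine mul_ne_zero (hd i k hik) (hd j l hjl) ?_
    simp only [homDet_eq_vecDet, vecDet] at h ⊢
    linear_combination -h
  · intro i j h
    exact inv_ne_zero (hz' i j h)
  · intro i j k l h
    simp only [List.nodup_cons, List.mem_cons, List.not_mem_nil, or_false, not_or, not_false_eq_true,
      List.nodup_nil, and_true] at h
    obtain ⟨⟨hij, hik, hil⟩, ⟨hjk, hjl⟩, hkl⟩ := h
    have d1 := hd i j hij
    have d2 := hd k l hkl
    rw [configRatio, configRatio, homDet_comm (configPoint z j) (configPoint z i),
      div_eq_iff (mul_ne_zero (neg_ne_zero.2 d1) d2)]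
    field_simp
    simp only [homDet_eq_vecDet, vecDet]
    ring
  · intro i j k l h
    simp only [List.nodup_cons, List.mem_cons, List.not_mem_nil, or_false, not_or, not_false_eq_true,
      List.nodup_nil, and_true] at h
    obtain ⟨⟨hij, hik, hil⟩, ⟨hjk, hjl⟩, hkl⟩ := h
    have d1 := hd i j hij
    have d2 := hd k l hkl
    rw [configRatio, configRatio, homDet_comm (configPoint z l) (configPoint z k),
      div_eq_iff (mul_ne_zero d1 (neg_ne_zero.2 d2))]
    field_simp
    simp only [homDet_eq_vecDet, vecDet]
    ring
  · intro i j k l h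
    simp only [List.nodup_cons, List.mem_cons, List.not_mem_nil, or_false, not_or, not_false_eq_true,
      List.nodup_nil, and_true] at h
    obtain ⟨⟨hij, hik, hil⟩, ⟨hjk, hjl⟩, hkl⟩ := h
    have d1 := hd i j hij
    have d2 := hd k l hkl
    have d3 := hd i k hik
    have d4 := hd j l hjl
    rw [configRatio, configRatio]
    field_simp
    simp only [homDet_eq_vecDet, vecDet]
    ring
  · intro i j h
    have h1 := hz' i j h
    have h2 := hz' j i h.symm
    field_simp
    ring
  · intro i j k l m h
    simp only [List.nodup_cons, List.mem_cons, List.not_mem_nil, or_false, not_or, not_false_eq_true,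
      List.nodup_nil, and_true] at h
    obtain ⟨⟨hij, hik, hil, him⟩, ⟨hjk, hjl, hjm⟩, ⟨hkl, hkm⟩, hlm⟩ := h
    have d1 := hd i j hij
    have d2 := hd k l hkl
    have d3 := hd k m hkm
    have d4 := hd j k hjk
    have d5 := hd l m hlm
    simp only [configRatio]
    field_simp
    simp only [homDet_eq_vecDet, vecDet]
    ring
  · intro i j k h
    simp only [List.nodup_cons, List.mem_cons, List.not_mem_nil, or_false, not_or, not_false_eq_true,
      List.nodup_nil, and_true] at h
    obtain ⟨⟨hij, hik⟩, hjk⟩ := h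
    have h1 := hz' i j hij
    have h2 := hz' j k hjk
    have h3 : z i - z j ≠ 0 := hz' j i (Ne.symm hij)
    simp only [configRatio, configPoint, Fin.cases_succ, Fin.cases_zero, homDet,
      OnePoint.elim_some, OnePoint.elim_infty]
    field_simp
    ring

namespace IsCrossRatioSystem

variable {r r' : Fin (n + 1) → Fin (n + 1) → Fin (n + 1) → Fin (n + 1) → ℂ} {s s' : Fin n → Fin n → ℂ}

/-- This is the cocycle identity of the differences `z_j - z_i`. It combines the recursion for `(i,
j, k)` and `(i, k, j)`, whose cross-ratios `R` and `R / (R - 1)` are linked by a symmetry. -/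
theorem s_inv_add (h : IsCrossRatioSystem r s) {i j k : Fin n} (hij : i ≠ j) (hik : i ≠ k)
    (hjk : j ≠ k) : (s i j)⁻¹ + (s j k)⁻¹ = (s i k)⁻¹ := by
  have hnd : [i.succ, j.succ, k.succ, 0].Nodup := by
    simp [hij, hik, hjk, Fin.succ_ne_zero]
  have h1 := h.s_recursion i j k (by simp [hij, hik, hjk])
  have h2 := h.s_recursion i k j (by simp [hij, hik, Ne.symm hjk])
  have h3 := h.r_symm₃ _ _ _ _ hnd
  have h4 := h.s_symm k j (Ne.symm hjk)
  have h5 := h.r_ne _ _ _ _ hnd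
  have e1 := h.s_ne _ _ hjk
  have h6 := sub_ne_zero.2 h5.2
  have h7 := h5.1
  set R := r i.succ j.succ k.succ 0
  have e2 : r i.succ k.succ j.succ 0 = R / (R - 1) := by rw [eq_div_iff h6, h3]
  rw [h4, e2] at h2
  rw [← h1, ← h2]
  field_simp
  ring

/-- A system of cross-ratios is determined by the coordinates `ρ_{ij}`. -/
theorem r_eq (h : IsCrossRatioSystem r s) (h' : IsCrossRatioSystem r' s')
    (hs : ∀ i j, i ≠ j → s i j = s' i j) (q : Fin 4 ↪o Fin (n + 1)) :
    r (q 0) (q 1) (q 2) (q 3) = r' (q 0) (q 1) (q 2) (q 3) := by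
  have key : ∀ i j k : Fin n, i ≠ j → i ≠ k → j ≠ k →
      r i.succ j.succ k.succ 0 = r' i.succ j.succ k.succ 0 := fun i j k hij hik hjk => by
    have h1 := h.s_recursion i j k (by simp [hij, hik, hjk])
    have h2 := h'.s_recursion i j k (by simp [hij, hik, hjk])
    rw [hs i j hij, hs j k hjk, ← h2] at h1
    have := mul_left_cancel₀ (h'.s_ne j k hjk) h1
    exact neg_injective this
  -- The index `0` is moved from the last place to the first by three transpositions of neighbours.
  have key' : ∀ i j k : Fin n, i ≠ j → i ≠ k → j ≠ k →
      r 0 i.succ j.succ k.succ = r' 0 i.succ j.succ k.succ := fun i j k hij hik hjk => by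
    have n1 : [i.succ, j.succ, k.succ, 0].Nodup := by
      simp [hij, hik, hjk, Fin.succ_ne_zero]
    have n2 : [i.succ, j.succ, 0, k.succ].Nodup := by
      simp [hij, hik, hjk, Fin.succ_ne_zero, (Fin.succ_ne_zero _).symm]
    have n3 : [i.succ, 0, j.succ, k.succ].Nodup := by
      simp [hij, hik, hjk, Fin.succ_ne_zero, (Fin.succ_ne_zero _).symm]
    have e2 : r i.succ j.succ 0 k.succ = r' i.succ j.succ 0 k.succ := by
      rw [h.r_symm₂ _ _ _ _ n1, h'.r_symm₂ _ _ _ _ n1, key i j k hij hik hjk]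
    have e3 : r i.succ 0 j.succ k.succ = r' i.succ 0 j.succ k.succ := by
      have a1 := h.r_symm₃ _ _ _ _ n2
      have a2 := h'.r_symm₃ _ _ _ _ n2
      rw [e2] at a1
      exact mul_right_cancel₀ (sub_ne_zero.2 (h'.r_ne _ _ _ _ n2).2) (a1.trans a2.symm)
    rw [h.r_symm₁ _ _ _ _ n3, h'.r_symm₁ _ _ _ _ n3, e3]
  have hq := q.injective
  have hpos : ∀ t : Fin 4, t ≠ 0 → q t ≠ 0 := fun t ht h0 => by
    have := q.strictMono (Fin.pos_iff_ne_zero.2 ht)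
    rw [h0] at this
    exact Fin.not_lt_zero _ this
  obtain ⟨j, hj⟩ := Fin.exists_succ_eq.2 (hpos 1 (by decide))
  obtain ⟨k, hk⟩ := Fin.exists_succ_eq.2 (hpos 2 (by decide))
  obtain ⟨l, hl⟩ := Fin.exists_succ_eq.2 (hpos 3 (by decide))
  have hjk : j ≠ k := by
    rintro rfl
    exact absurd (hq (hj.symm.trans hk)) (by decide)
  have hjl : j ≠ l := by
    rintro rfl
    exact absurd (hq (hj.symm.trans hl)) (by decide)
  have hkl : k ≠ l := by
    rintro rfl
    exact absurd (hq (hk.symm.trans hl)) (by decide)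
  rw [← hj, ← hk, ← hl]
  by_cases h0 : q 0 = 0
  · rw [h0]
    exact key' j k l hjk hjl hkl
  · obtain ⟨i, hi⟩ := Fin.exists_succ_eq.2 h0
    have hij : i ≠ j := by
      rintro rfl
      exact absurd (hq (hi.symm.trans hj)) (by decide)
    have hik : i ≠ k := by
      rintro rfl
      exact absurd (hq (hi.symm.trans hk)) (by decide)
    have hil : i ≠ l := by
      rintro rfl
      exact absurd (hq (hi.symm.trans hl)) (by decide)
    rw [← hi]
    have n1 : [0, i.succ, j.succ, k.succ, l.succ].Nodup := by
      simp [hij, hik, hil, hjk, hjl, hkl, (Fin.succ_ne_zero _).symm]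
    have n2 : [0, i.succ, j.succ, l.succ].Nodup := by
      simp [hij, hil, hjl, (Fin.succ_ne_zero _).symm]
    have a1 := h.r_recursion _ _ _ _ _ n1
    have a2 := h'.r_recursion _ _ _ _ _ n1
    rw [key' i j l hij hil hjl, key' i j k hij hik hjk, ← a2] at a1
    -- The factor is nonzero because the right-hand side of the recursion, a cross-ratio minus `1`,
    -- is.
    refine mul_right_cancel₀ (fun hz => ?_) a1
    rw [hz, mul_zero] at a2
    exact sub_ne_zero.2 (h'.r_ne _ _ _ _ n2).2 a2.symm

end IsCrossRatioSystem

theorem configCrossRatios_mem {z : Fin n → ℂ} (hz : Function.Injective z) :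
    configCrossRatios z ∈ openCrossRatioVariety n :=
  ⟨_, _, isCrossRatioSystem_config hz, fun q => crossRatio_configPoint hz q.injective, fun _ => rfl⟩

/-- With the first point placed at `0`, the others must be `1 / ρ_{aj}`; additivity then gives all
`ρ_{ij}`, and these give the cross-ratios. -/
theorem exists_config_of_mem (hn : 1 ≤ n) {p : CrossRatioSpace n} (hp : p ∈ openCrossRatioVariety n) :
    ∃ z : Fin n → ℂ, Function.Injective z ∧ configCrossRatios z = p := by
  classical
  obtain ⟨r, s, h, h4, h2⟩ := hp
  let a : Fin n := ⟨0, hn⟩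
  let z : Fin n → ℂ := fun j => if j = a then 0 else (s a j)⁻¹
  have hza : z a = 0 := if_pos rfl
  have hzj : ∀ j, j ≠ a → z j = (s a j)⁻¹ := fun j hj => if_neg hj
  have hs : ∀ i j, i ≠ j → s i j = (z j - z i)⁻¹ := fun i j hij => by
    by_cases hi : i = a
    · subst hi
      rw [hza, hzj j hij.symm, sub_zero, inv_inv]
    · by_cases hj : j = a
      · subst hj
        rw [hza, hzj i hi, zero_sub, inv_neg, inv_inv, h.s_symm i _ hi]
      · rw [hzj i hi, hzj j hj, ← h.s_inv_add (Ne.symm hi) (Ne.symm hj) hij, add_sub_cancel_left,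
          inv_inv]
  have hz : Function.Injective z := fun i j hij => by
    by_contra hne
    refine h.s_ne i j hne ?_
    rw [hs i j hne, hij, sub_self, inv_zero]
  refine ⟨z, hz, Prod.ext (funext fun q => ?_) (funext fun q => ?_)⟩
  · rw [h4, h.r_eq (isCrossRatioSystem_config hz) hs]
    exact crossRatio_configPoint hz q.injective
  · rw [h2, hs _ _ (q.injective.ne (by decide))]
    rfl

end Config

/-! ### Finite tree orders and their parent functions. -/

section Order

variable {V : Type*} [Finite V] [PartialOrder V]

theorem exists_isLeast_of_total {s : Set V} (hne : s.Nonempty)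
    (h : ∀ v ∈ s, ∀ w ∈ s, v ≤ w ∨ w ≤ v) : ∃ m, IsLeast s m := by
  obtain ⟨m, hm⟩ := s.toFinite.exists_minimal hne
  exact ⟨m, hm.prop, fun w hw => (h m hm.prop w hw).elim id fun h' => hm.le_of_le hw h'⟩

theorem exists_forall_le_of_directed [Nonempty V] (h : ∀ u v : V, ∃ w, u ≤ w ∧ v ≤ w) :
    ∃ r : V, ∀ v, v ≤ r := by
  obtain ⟨m, hm⟩ := (Set.univ : Set V).toFinite.exists_maximal Set.univ_nonempty
  refine ⟨m, fun v => ?_⟩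
  obtain ⟨w, hw, hvw⟩ := h m v
  exact hvw.trans (hm.le_of_ge (Set.mem_univ w) hw)

/-- A parent function of a finite order with greatest element `r` whose upper sets are chains. -/
theorem exists_parent {r : V} (hr : ∀ v, v ≤ r)
    (h : ∀ u v w : V, u ≤ v → u ≤ w → v ≤ w ∨ w ≤ v) :
    ∃ p : V → V, p r = r ∧ ∀ v, v ≠ r → IsLeast (Set.Ioi v) (p v) := by
  classical
  have : ∀ v, v ≠ r → ∃ m, IsLeast (Set.Ioi v) m := fun v hv =>
    exists_isLeast_of_total ⟨r, lt_of_le_of_ne (hr v) hv⟩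
      fun a ha b hb => h v a b (le_of_lt ha) (le_of_lt hb)
  choose! p hp using this
  refine ⟨fun v => if v = r then r else p v, if_pos rfl, fun v hv => ?_⟩
  simpa only [hv, if_false] using hp v hv

theorem exists_iterate_eq_iff {r : V} (hr : ∀ v, v ≤ r) {p : V → V} (hpr : p r = r)
    (hp : ∀ v, v ≠ r → IsLeast (Set.Ioi v) (p v)) {v w : V} :
    (∃ k : ℕ, p^[k] v = w) ↔ v ≤ w := by
  constructor
  · rintro ⟨k, rfl⟩
    have hle : ∀ v, v ≤ p v := fun v => by
      by_cases hv : v = r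
      · rw [hv, hpr]
      · exact le_of_lt (hp v hv).1
    induction k with
    | zero => exact le_rfl
    | succ k ih =>
      rw [Function.iterate_succ_apply']
      exact ih.trans (hle _)
  · induction v using WellFoundedGT.induction with
    | ind v ih =>
      intro hvw
      by_cases hne : v = w
      · exact ⟨0, hne⟩
      · have hlt := lt_of_le_of_ne hvw hne
        have hv : v ≠ r := (hlt.trans_le (hr w)).ne
        obtain ⟨k, hk⟩ := ih (p v) (hp v hv).1 ((hp v hv).2 hlt)
        exact ⟨k + 1, by rwa [Function.iterate_succ_apply]⟩

end Order

/-! ### Orders of growth along an ultrafilter. -/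

section Ultrafilter

variable {T : Type*} {l : Ultrafilter T}

/-- Along an ultrafilter, a bound that does not hold eventually fails eventually. So when no
constant bounds `f` by `g`, every constant gives the reverse bound. -/
theorem isBigO_or_isLittleO (f g : T → ℂ) : f =O[(l : Filter T)] g ∨ g =o[(l : Filter T)] f := by
  by_cases h : f =O[(l : Filter T)] g
  · exact .inl h
  · refine .inr (isLittleO_iff.2 fun c hc => ?_)
    have h1 : ¬ ∀ᶠ t in (l : Filter T), ‖f t‖ ≤ c⁻¹ * ‖g t‖ := fun h' => h (.of_bound _ h')
    filter_upwards [Ultrafilter.eventually_not.2 h1] with t ht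
    rw [not_le, inv_mul_lt_iff₀ hc] at ht
    exact ht.le

theorem exists_tendsto_onePoint (f : T → OnePoint ℂ) : ∃ x, Tendsto f l (𝓝 x) := by
  obtain ⟨x, -, hx⟩ := isCompact_univ.ultrafilter_le_nhds (l.map f) (by simp)
  exact ⟨x, hx⟩

theorem isBigO_of_tendsto_coe {f e : T → ℂ} (he : ∀ᶠ t in (l : Filter T), e t ≠ 0) {x : ℂ}
    (h : Tendsto (fun t => f t / e t) l (𝓝 x)) : f =O[(l : Filter T)] e := by
  have h1 := (h.isBigO_one ℂ).mul (isBigO_refl e (l : Filter T))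
  refine h1.congr' ?_ (.of_forall fun t => one_mul _)
  filter_upwards [he] with t ht
  exact div_mul_cancel₀ _ ht

theorem isBigO_iff_ne_infty {f e : T → ℂ} (he : ∀ᶠ t in (l : Filter T), e t ≠ 0) {x : OnePoint ℂ}
    (h : Tendsto (fun t => ((f t / e t : ℂ) : OnePoint ℂ)) l (𝓝 x)) :
    f =O[(l : Filter T)] e ↔ x ≠ ∞ := by
  constructor
  · rintro hO rfl
    rw [tendsto_coe_infty_iff] at h
    obtain ⟨C, hC⟩ := hO.bound
    obtain ⟨t, h1, h2, h3⟩ := (hC.and (he.and (h.eventually_gt_atTop C))).exists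
    rw [norm_div, lt_div_iff₀ (norm_pos_iff.2 h2)] at h3
    exact not_le.2 h3 h1
  · intro hx
    obtain ⟨y, rfl⟩ := OnePoint.ne_infty_iff_exists.1 hx
    exact isBigO_of_tendsto_coe he (tendsto_coe_coe_iff.1 h)

theorem not_isLittleO_of_isBigO {e f : T → ℂ} (he : ∀ᶠ t in (l : Filter T), e t ≠ 0)
    (h : e =O[(l : Filter T)] f) : ¬ f =o[(l : Filter T)] e := fun h' =>
  isLittleO_irrefl he.frequently (h.trans_isLittleO h')

end Ultrafilter

/-! ### The tree of discs and its stable line. -/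

/-- The difference of two of the points. -/
def gap {T : Type*} {n : ℕ} (z : T → Fin n → ℂ) (i j : Fin n) : T → ℂ := fun t => z t i - z t j

theorem gap_add {T : Type*} {n : ℕ} (z : T → Fin n → ℂ) (i j k : Fin n) :
    (fun t => gap z i j t + gap z j k t) = gap z i k := by
  ext t; simp [gap]

theorem gap_sub {T : Type*} {n : ℕ} (z : T → Fin n → ℂ) (i j k : Fin n) :
    (fun t => gap z i k t - gap z j k t) = gap z i j := by
  ext t; simp [gap]

theorem gap_sub_left {T : Type*} {n : ℕ} (z : T → Fin n → ℂ) (i j k : Fin n) :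
    (fun t => gap z i k t - gap z i j t) = gap z j k := by
  ext t; simp [gap]

theorem gap_neg {T : Type*} {n : ℕ} (z : T → Fin n → ℂ) (i j : Fin n) :
    (fun t => - gap z i j t) = gap z j i := by
  ext t; simp [gap]

theorem gap_self {T : Type*} {n : ℕ} (z : T → Fin n → ℂ) (i : Fin n) :
    gap z i i = fun _ => 0 := by
  ext t; simp [gap]

/-- The discs, up to comparability, with radius `1` or the distance of two of the points, around
points that depend on a parameter. -/
structure DiscSystem {T : Type*} {n : ℕ} (l : Ultrafilter T) (z : T → Fin n → ℂ) where
  /-- the discs -/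
  V : Type
  finite : Finite V
  order : PartialOrder V
  center : V → Fin n
  radius : V → T → ℂ
  radius_ne : ∀ v, ∀ᶠ t in (l : Filter T), radius v t ≠ 0
  le_iff : ∀ u v, u ≤ v ↔ radius u =O[(l : Filter T)] radius v ∧
    gap z (center u) (center v) =O[(l : Filter T)] radius v
  -- Frames become the components separating two markings, unit discs the non-degenerate components.
  -- That every disc is of one of these kinds yields stability.
  exists_frame : ∀ i j, i ≠ j → ∃ v, gap z i (center v) =O[(l : Filter T)] radius v ∧
    gap z j (center v) =O[(l : Filter T)] radius v ∧ radius v =O[(l : Filter T)] gap z i j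
  exists_unit : ∀ i, ∃ v, gap z i (center v) =O[(l : Filter T)] radius v ∧
    radius v =O[(l : Filter T)] (fun _ => (1 : ℂ)) ∧
    (fun _ => (1 : ℂ)) =O[(l : Filter T)] radius v
  frame_or_unit : ∀ v, (∃ i j, gap z i (center v) =O[(l : Filter T)] radius v ∧
    gap z j (center v) =O[(l : Filter T)] radius v ∧ radius v =O[(l : Filter T)] gap z i j) ∨
    (radius v =O[(l : Filter T)] (fun _ => (1 : ℂ)) ∧
      (fun _ => (1 : ℂ)) =O[(l : Filter T)] radius v)

namespace DiscSystem

variable {T : Type*} {n : ℕ} {l : Ultrafilter T} {z : T → Fin n → ℂ} (D : DiscSystem l z)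

attribute [instance] DiscSystem.order DiscSystem.finite

/-- The point `zₖ` lies in the disc `v`. -/
def Mem (k : Fin n) (v : D.V) : Prop := gap z k (D.center v) =O[(l : Filter T)] D.radius v

variable {D}

theorem mem_center (v : D.V) : D.Mem (D.center v) v := by
  rw [Mem, gap_self]; exact isBigO_zero _ _

theorem le_iff_mem {u v : D.V} :
    u ≤ v ↔ D.radius u =O[(l : Filter T)] D.radius v ∧ D.Mem (D.center u) v := D.le_iff u v

theorem Mem.gap_isBigO {i j : Fin n} {v : D.V} (hi : D.Mem i v) (hj : D.Mem j v) :
    gap z i j =O[(l : Filter T)] D.radius v := by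
  have := IsBigO.sub hi hj
  rwa [gap_sub] at this

theorem Mem.of_gap {i j : Fin n} {v : D.V} (hi : D.Mem i v)
    (h : gap z i j =O[(l : Filter T)] D.radius v) : D.Mem j v := by
  have := IsBigO.sub hi h
  rwa [gap_sub_left] at this

theorem Mem.of_le {k : Fin n} {u v : D.V} (h : D.Mem k u) (huv : u ≤ v) : D.Mem k v := by
  obtain ⟨h1, h2⟩ := le_iff_mem.1 huv
  have := IsBigO.add (IsBigO.trans h h1) h2
  rwa [gap_add] at this

/-- As in an ultrametric space, discs with a common point are nested according to their radii. -/
theorem le_of_mem {k : Fin n} {u v : D.V} (hu : D.Mem k u) (hv : D.Mem k v)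
    (h : D.radius u =O[(l : Filter T)] D.radius v) : u ≤ v := by
  refine le_iff_mem.2 ⟨h, hv.of_gap ?_⟩
  exact IsBigO.trans hu h

theorem isLittleO_of_lt {u v : D.V} (h : u < v) :
    D.radius u =o[(l : Filter T)] D.radius v := by
  refine (isBigO_or_isLittleO (D.radius v) (D.radius u)).resolve_left fun h' => ?_
  exact not_le_of_gt h (le_of_mem ((mem_center u).of_le h.le) (mem_center u) h')

theorem gap_isLittleO_of_lt {u v : D.V} (h : u < v) {i j : Fin n} (hi : D.Mem i u)
    (hj : D.Mem j u) : gap z i j =o[(l : Filter T)] D.radius v :=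
  (hi.gap_isBigO hj).trans_isLittleO (isLittleO_of_lt h)

theorem Mem.total {k : Fin n} {u v : D.V} (hu : D.Mem k u) (hv : D.Mem k v) : u ≤ v ∨ v ≤ u :=
  (isBigO_or_isLittleO (D.radius u) (D.radius v)).imp (fun h => le_of_mem hu hv h)
    fun h => le_of_mem hv hu h.isBigO

theorem le_total_of_le (u v w : D.V) (hv : u ≤ v) (hw : u ≤ w) : v ≤ w ∨ w ≤ v :=
  ((mem_center u).of_le hv).total ((mem_center u).of_le hw)

/-- Points that merge in the coordinate of `v` lie together in a strictly smaller disc. This is what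
keeps markings and nodes distinct. -/
theorem exists_lt_of_gap_isLittleO {i j : Fin n} (hij : i ≠ j) {v : D.V} (hi : D.Mem i v)
    (h : gap z i j =o[(l : Filter T)] D.radius v) : ∃ u < v, D.Mem i u ∧ D.Mem j u := by
  obtain ⟨u, hiu, hju, hu⟩ := D.exists_frame i j hij
  refine ⟨u, lt_of_le_of_ne (le_of_mem hiu hi (hu.trans h.isBigO)) ?_, hiu, hju⟩
  rintro rfl
  exact not_isLittleO_of_isBigO (D.radius_ne u) hu h

/-- If one disc contains the other's centre, the two are nested; otherwise the disc spanned by the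
two centres contains both. -/
theorem exists_le_le (u v : D.V) : ∃ w, u ≤ w ∧ v ≤ w := by
  have of_mem : ∀ {k}, D.Mem k u → D.Mem k v → ∃ w, u ≤ w ∧ v ≤ w := fun hu hv =>
    (hu.total hv).elim (fun h => ⟨v, h, le_rfl⟩) fun h => ⟨u, le_rfl, h⟩
  rcases isBigO_or_isLittleO (l := l) (gap z (D.center u) (D.center v)) (D.radius v) with h1 | h1
  · exact of_mem (mem_center u) h1
  rcases isBigO_or_isLittleO (l := l) (gap z (D.center u) (D.center v)) (D.radius u) with h2 | h2
  · exact of_mem ((mem_center u).of_gap h2) (mem_center v)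
  have hne : D.center u ≠ D.center v := fun h => by
    rw [h] at h1
    exact not_isLittleO_of_isBigO (D.radius_ne v) h1.isBigO (by
      rw [gap_self]; exact isLittleO_zero _ _)
  obtain ⟨w, huw, hvw, -⟩ := D.exists_frame _ _ hne
  have hg : gap z (D.center u) (D.center v) =O[(l : Filter T)] D.radius w :=
    Mem.gap_isBigO (D := D) huw hvw
  exact ⟨w, le_iff_mem.2 ⟨h2.isBigO.trans hg, huw⟩, le_iff_mem.2 ⟨h1.isBigO.trans hg, hvw⟩⟩

/-- The tree of discs is a stable nodal scaled line, the limit of the irreducible lines. -/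
theorem exists_isLimit (D : DiscSystem l z) [Nonempty D.V] :
    ∃ S : NodalScaledLine n, S.Stable ∧ ∃ b e, S.IsLimit l z b e := by
  obtain ⟨r, hr⟩ := exists_forall_le_of_directed (exists_le_le (D := D))
  obtain ⟨p, hpr, hp⟩ := exists_parent hr le_total_of_le
  have hiter := fun v w : D.V => exists_iterate_eq_iff hr hpr hp (v := v) (w := w)
  have hplt : ∀ v, v ≠ r → v < p v := fun v hv => (hp v hv).1
  have hple : ∀ v w, v < w → p v ≤ w := fun v w h => (hp v (h.trans_le (hr w)).ne).2 h
  -- The marking `zₖ` is placed on the smallest disc containing it.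
  have hcomp : ∀ k, ∃ v, IsLeast {v | D.Mem k v} v := fun k =>
    exists_isLeast_of_total ((D.exists_unit k).imp fun v h => h.1) fun v hv w hw => hv.total hw
  choose comp hc using hcomp
  have hmem : ∀ k v, D.Mem k v ↔ comp k ≤ v := fun k v => ⟨fun h => (hc k).2 h, (hc k).1.of_le⟩
  choose pos hpos using fun (v : D.V) (k : Fin n) => exists_tendsto_onePoint (l := l)
    fun t => ((gap z k (D.center v) t / D.radius v t : ℂ) : OnePoint ℂ)
  choose scale hscale using fun v : D.V => exists_tendsto_onePoint (l := l)
    fun t => (D.radius v t : OnePoint ℂ)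
  have hposmem : ∀ v k, pos v k ≠ ∞ ↔ D.Mem k v := fun v k =>
    (isBigO_iff_ne_infty (D.radius_ne v) (hpos v k)).symm
  have hposeq : ∀ v i j, D.Mem i v → D.Mem j v →
      (pos v i = pos v j ↔ gap z i j =o[(l : Filter T)] D.radius v) := fun v i j hi hj => by
    obtain ⟨x, hx⟩ := OnePoint.ne_infty_iff_exists.1 ((hposmem v i).2 hi)
    obtain ⟨y, hy⟩ := OnePoint.ne_infty_iff_exists.1 ((hposmem v j).2 hj)
    have h1 := hpos v i
    have h2 := hpos v j
    rw [← hx, tendsto_coe_coe_iff] at h1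
    rw [← hy, tendsto_coe_coe_iff] at h2
    have h3 : Tendsto (fun t => gap z i j t / D.radius v t) l (𝓝 (x - y)) := by
      refine (h1.sub h2).congr fun t => ?_
      simp only [gap]
      ring
    rw [isLittleO_iff_tendsto' ((D.radius_ne v).mono fun t ht h0 => absurd h0 ht), ← hx, ← hy,
      OnePoint.coe_eq_coe]
    refine ⟨fun h => ?_, fun h => sub_eq_zero.1 (tendsto_nhds_unique h3 h)⟩
    rwa [h, sub_self] at h3
  -- The default `0` of the positions is never reached for points of the disc.
  have hval : ∀ v k, D.Mem k v → (((pos v k).elim 0 id : ℂ) : OnePoint ℂ) = pos v k :=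
    fun v k hk => by
      obtain ⟨x, hx⟩ := OnePoint.ne_infty_iff_exists.1 ((hposmem v k).2 hk)
      rw [← hx]
      rfl
  have hcenter : ∀ v, v ≠ r → D.Mem (D.center v) (p v) := fun v hv =>
    (mem_center v).of_le (hplt v hv).le
  have hone : ∀ v : D.V, D.radius v =O[(l : Filter T)] (fun _ => (1 : ℂ)) → scale v ≠ ∞ :=
    fun v h => (isBigO_iff_ne_infty (.of_forall fun _ => one_ne_zero)
      (by simpa using hscale v)).1 h
  have hzero : ∀ v : D.V, scale v = ((0 : ℂ) : OnePoint ℂ) ↔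
      D.radius v =o[(l : Filter T)] (fun _ => (1 : ℂ)) := fun v => by
    rw [isLittleO_one_iff, ← tendsto_coe_coe_iff]
    exact ⟨fun h => h ▸ hscale v, tendsto_nhds_unique (hscale v)⟩
  have hunit : ∀ v : D.V, (fun _ => (1 : ℂ)) =O[(l : Filter T)] D.radius v →
      scale v ≠ ((0 : ℂ) : OnePoint ℂ) := fun v h h0 =>
    not_isLittleO_of_isBigO (.of_forall fun _ => one_ne_zero) h ((hzero v).1 h0)
  have hincomp : ∀ v w, v ≠ w → v ≠ r → w ≠ r → p v = p w → ¬ (v ≤ w ∨ w ≤ v) := by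
    rintro v w hne hv hw h (h' | h')
    · exact absurd ((hple v w (lt_of_le_of_ne h' hne)).trans_lt (hplt w hw)) (by simp [h])
    · exact absurd ((hple w v (lt_of_le_of_ne h' hne.symm)).trans_lt (hplt v hv)) (by simp [h])
  let S : NodalScaledLine n :=
    { V := D.V
      finite := D.finite
      root := r
      parent := p
      parent_root := hpr
      reach_root := fun v => (hiter v r).2 (hr v)
      node := fun v => (pos (p v) (D.center v)).elim 0 id
      comp := comp
      mark := fun k => (pos (comp k) k).elim 0 id
      scale := scale
      mark_ne_mark := fun i j hij h he => by
        have hj := (hc j).1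
        rw [← h] at hj
        rw [← h, ← OnePoint.coe_eq_coe, hval _ _ (hc i).1, hval _ _ hj,
          hposeq _ _ _ (hc i).1 hj] at he
        obtain ⟨u, hu, hiu, -⟩ := exists_lt_of_gap_isLittleO hij (hc i).1 he
        exact not_le_of_gt hu ((hc i).2 hiu)
      node_ne_node := fun v w hne hv hw h he => by
        have hcw := hcenter w hw
        rw [← h] at hcw
        rw [← h, ← OnePoint.coe_eq_coe, hval _ _ (hcenter v hv), hval _ _ hcw,
          hposeq _ _ _ (hcenter v hv) hcw] at he
        have hinc := hincomp v w hne hv hw h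
        by_cases hcc : D.center v = D.center w
        · exact hinc ((hcc ▸ mem_center v).total (mem_center w))
        -- Coinciding nodes give a disc `u` below the common parent that contains both centres. As
        -- no disc lies strictly between a child and its parent, `u` is below `v` and `w`, which
        -- makes these siblings comparable.
        · obtain ⟨u, hu, hvu, hwu⟩ := exists_lt_of_gap_isLittleO hcc (hcenter v hv) he
          have h1 : u ≤ v := by
            rcases hvu.total (mem_center v) with h' | h'
            · exact h'
            · by_contra hlt
              exact not_le_of_gt hu (hple v u (lt_of_le_not_ge h' hlt))
          have h2 : u ≤ w := by
            rcases hwu.total (mem_center w) with h' | h'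
            · exact h'
            · by_contra hlt
              exact not_le_of_gt hu (h ▸ hple w u (lt_of_le_not_ge h' hlt))
          exact hinc (le_total_of_le u v w h1 h2)
      node_ne_mark := fun v i hv h he => by
        have hcv := hcenter v hv
        rw [h] at hcv
        rw [h, ← OnePoint.coe_eq_coe, hval _ _ hcv, hval _ _ (hc i).1,
          hposeq _ _ _ hcv (hc i).1] at he
        by_cases hci : D.center v = i
        · have := (hc i).2 (hci ▸ mem_center v)
          exact not_le_of_gt (h ▸ hplt v hv) this
        · obtain ⟨u, hu, -, hiu⟩ := exists_lt_of_gap_isLittleO hci hcv he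
          exact not_le_of_gt hu ((hc i).2 hiu)
      colored := fun i => by
        -- The unit disc around `zᵢ` is the non-degenerate component: smaller radii tend to `0`,
        -- larger ones to `∞`.
        obtain ⟨N, hiN, hN1, hN2⟩ := D.exists_unit i
        obtain ⟨k, hk⟩ := (hiter (comp i) N).2 ((hc i).2 hiN)
        refine ⟨k, ?_⟩
        rw [hk]
        refine ⟨⟨hunit N hN2, hone N hN1⟩, fun m hm => ⟨fun hmk => ?_, fun hkm => ?_⟩⟩
        · have hlt : p^[m] (comp i) < N := by
            refine lt_of_le_of_ne ((hiter _ _).1 ⟨k - m, ?_⟩) hm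
            rw [← Function.iterate_add_apply, Nat.sub_add_cancel hmk.le, hk]
          exact (hzero _).2 ((isLittleO_of_lt hlt).trans_isBigO hN1)
        · have hlt : N < p^[m] (comp i) := by
            refine lt_of_le_of_ne ((hiter _ _).1 ⟨m - k, ?_⟩) (Ne.symm hm)
            rw [← hk, ← Function.iterate_add_apply, Nat.sub_add_cancel hkm.le]
          have := hN2.trans_isLittleO (isLittleO_of_lt hlt)
          rw [isLittleO_one_left_iff, ← tendsto_coe_infty_iff] at this
          exact tendsto_nhds_unique (hscale _) this }
  have hbelow : ∀ u v : D.V, S.Below u v ↔ u ≤ v := hiter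
  -- The special points read off from the tree agree with the limits: a point of a child and the
  -- child's centre have the same limit in the parent.
  have hspecial : ∀ (v : D.V) k, S.special v k.succ = pos v k := fun v k => by
    by_cases hk : comp k ≤ v
    · by_cases hkv : comp k = v
      · subst hkv
        exact (S.special_comp k).trans (hval _ _ (hc k).1)
      · obtain ⟨w, hw, rfl, hkw⟩ := ((hbelow (comp k) v).2 hk).exists_child hkv
        have h1 : D.Mem k w := (hmem k w).2 ((hbelow _ _).1 hkw)
        have hlt := hplt w hw
        refine (S.special_parent hw hkw).trans ((hval _ _ (hcenter w hw)).trans ?_)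
        exact (hposeq _ _ _ (hcenter w hw) (h1.of_le hlt.le)).2
          (gap_isLittleO_of_lt hlt (mem_center w) h1)
    · refine (S.special_succ_of_not_below fun h => hk ((hbelow _ _).1 h)).trans ?_
      exact (not_not.1 fun h => hk ((hmem k v).1 ((hposmem v k).1 h))).symm
  refine ⟨S, fun v => ?_, fun v t => z t (D.center v), D.radius, D.radius_ne, fun v k => ?_,
    hscale⟩
  · rcases D.frame_or_unit v with ⟨i, j, hi, hj, hv⟩ | ⟨h1, h2⟩
    · have hsep : S.Separates v i j := by
        refine ⟨?_, ?_, ?_⟩ <;> rw [hspecial]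
        · exact (hposmem v i).2 hi
        · rw [hposmem]; exact hj
        · rw [hspecial, Ne, hposeq v i j hi hj]
          exact not_isLittleO_of_isBigO (D.radius_ne v) hv
      have := hsep.three_le_numSpecial
      exact ⟨by omega, fun _ => this⟩
    · refine ⟨NodalScaledLine.two_le_numSpecial (i := D.center v)
        ((hbelow _ _).2 ((hmem _ _).1 (mem_center v))), fun hd => ?_⟩
      exact (hd.elim (hunit v h2) (hone v h1)).elim
  · rw [hspecial]
    exact hpos v k

end DiscSystem

/-! ### The discs of a family of distinct points. -/

section Frames

variable {T : Type*} {n : ℕ} (l : Ultrafilter T) (z : T → Fin n → ℂ)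

/-- The distance of two of the points, or `1` for equal indices. -/
def frameRadius (p : Fin n × Fin n) : T → ℂ := if p.1 = p.2 then fun _ => 1 else gap z p.1 p.2

/-- The disc with center `z p.1` and radius `frameRadius p` lies in the disc given by `q`. -/
def FrameLE (p q : Fin n × Fin n) : Prop :=
  frameRadius z p =O[(l : Filter T)] frameRadius z q ∧
    gap z p.1 q.1 =O[(l : Filter T)] frameRadius z q

variable {l z}

theorem FrameLE.refl (p : Fin n × Fin n) : FrameLE l z p p :=
  ⟨isBigO_refl _ _, by rw [gap_self]; exact isBigO_zero _ _⟩

theorem FrameLE.trans {p q r : Fin n × Fin n} (h : FrameLE l z p q) (h' : FrameLE l z q r) :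
    FrameLE l z p r := by
  refine ⟨h.1.trans h'.1, ?_⟩
  have := (h.2.trans h'.1).add h'.2
  rwa [gap_add] at this

variable (l z)

/-- Discs that contain each other are identified. -/
def frameSetoid : Setoid (Fin n × Fin n) where
  r p q := FrameLE l z p q ∧ FrameLE l z q p
  iseqv := ⟨fun p => ⟨.refl p, .refl p⟩, fun h => ⟨h.2, h.1⟩,
    fun h h' => ⟨h.1.trans h'.1, h'.2.trans h.2⟩⟩

/-- The disc system of pairwise different points. -/
noncomputable def discSystem (hz : ∀ i j, i ≠ j → ∀ᶠ t in (l : Filter T), z t i ≠ z t j) :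
    DiscSystem l z where
  V := Quotient (frameSetoid l z)
  finite := inferInstance
  order :=
    { le := fun u v => FrameLE l z u.out v.out
      lt := fun u v => FrameLE l z u.out v.out ∧ ¬ FrameLE l z v.out u.out
      lt_iff_le_not_ge := fun _ _ => Iff.rfl
      le_refl := fun u => .refl _
      le_trans := fun u v w h h' => h.trans h'
      le_antisymm := fun u v h h' => by
        rw [← u.out_eq, ← v.out_eq]
        exact Quotient.sound ⟨h, h'⟩ }
  center v := v.out.1
  radius v := frameRadius z v.out
  radius_ne v := by
    rw [frameRadius]
    split_ifs with h
    · exact .of_forall fun _ => one_ne_zero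
    · exact (hz _ _ h).mono fun t ht => sub_ne_zero.2 ht
  le_iff u v := Iff.rfl
  exists_frame i j hij := by
    have h : FrameLE l z _ _ ∧ FrameLE l z _ _ := @Quotient.mk_out _ (frameSetoid l z) (i, j)
    have hr : frameRadius z (i, j) = gap z i j := if_neg hij
    refine ⟨@Quotient.mk _ (frameSetoid l z) (i, j), h.2.2, ?_, ?_⟩
    · have := h.2.2.sub (hr ▸ h.2.1)
      rwa [gap_sub_left] at this
    · have := h.1.1
      rwa [hr] at this
  exists_unit i := by
    have h : FrameLE l z _ _ ∧ FrameLE l z _ _ := @Quotient.mk_out _ (frameSetoid l z) (i, i)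
    have hr : frameRadius z (i, i) = fun _ => 1 := if_pos rfl
    refine ⟨@Quotient.mk _ (frameSetoid l z) (i, i), h.2.2, ?_, ?_⟩
    · have := h.1.1
      rwa [hr] at this
    · have := h.2.1
      rwa [hr] at this
  frame_or_unit v := by
    by_cases h : v.out.1 = v.out.2
    · have hr : frameRadius z v.out = fun _ => 1 := if_pos h
      rw [hr]
      exact .inr ⟨isBigO_refl _ _, isBigO_refl _ _⟩
    · have hr : frameRadius z v.out = gap z v.out.1 v.out.2 := if_neg h
      rw [hr]
      refine .inl ⟨v.out.1, v.out.2, ?_, ?_, isBigO_refl _ _⟩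
      · rw [gap_self]; exact isBigO_zero _ _
      · rw [← gap_neg]; exact (isBigO_refl _ _).neg_left

end Frames

/-! ### The image is the closure. -/

theorem NodalScaledLine.Stable.crossRatios_mem {n : ℕ} {S : NodalScaledLine n} (hS : S.Stable) :
    S.crossRatios ∈ crossRatioVariety n := by
  obtain ⟨b, e, h⟩ := hS.exists_isLimit
  refine mem_closure_of_tendsto h.tendsto_crossRatios ?_
  have : ∀ᶠ t in 𝓝[≠] (0 : ℂ), ∀ i j, i ≠ j → S.smoothing t i ≠ S.smoothing t j := by
    rw [eventually_all]
    intro i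
    rw [eventually_all]
    intro j
    by_cases hij : i = j
    · simp [hij]
    · exact (h.eventually_ne hij).mono fun t ht _ => ht
  exact this.mono fun t ht => configCrossRatios_mem fun i j hij => by_contra fun hne => ht i j hne hij

/-- The parameter space is the product of projective lines itself, with an ultrafilter on the open
variety that converges to `p`. The coordinates of the chosen configurations tend both to `p` and to
those of the limit line, and limits are unique. -/
theorem exists_stable_of_mem_crossRatioVariety {n : ℕ} (hn : 1 ≤ n) {p : CrossRatioSpace n}
    (hp : p ∈ crossRatioVariety n) : ∃ S : NodalScaledLine n, S.Stable ∧ S.crossRatios = p := by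
  obtain ⟨l, hl, hlp⟩ := mem_closure_iff_ultrafilter.1 hp
  choose! z hz hzp using fun x hx => exists_config_of_mem (n := n) hn (p := x) hx
  have hne : ∀ i j, i ≠ j → ∀ᶠ t in (l : Filter (CrossRatioSpace n)), z t i ≠ z t j :=
    fun i j hij => mem_of_superset hl fun t ht => (hz t ht).ne hij
  have : Nonempty (discSystem l z hne).V := ⟨((discSystem l z hne).exists_unit ⟨0, hn⟩).choose⟩
  obtain ⟨S, hS, b, e, h⟩ := (discSystem l z hne).exists_isLimit
  refine ⟨S, hS, tendsto_nhds_unique h.tendsto_crossRatios ?_⟩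
  refine Tendsto.congr' ?_ (f₁ := id) hlp
  exact mem_of_superset hl fun t ht => (hzp t ht).symm

theorem mainTheorem5 (n : ℕ) (hn : 1 ≤ n) :
    Set.BijOn (crossRatioMap n) Set.univ (crossRatioVariety n) := by
  refine ⟨?_, ?_, ?_⟩
  · rintro ⟨S, hS⟩ -
    exact hS.crossRatios_mem
  · rintro ⟨S, hS⟩ - ⟨T, hT⟩ - h
    exact Quotient.sound (NodalScaledLine.nonempty_iso_of_crossRatios_eq hS hT h)
  · intro p hp
    obtain ⟨S, hS, h⟩ := exists_stable_of_mem_crossRatioVariety hn hp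
    exact ⟨Quotient.mk _ ⟨S, hS⟩, Set.mem_univ _, h⟩
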